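/- **Data.** Let $p_1=(a_1:b_1)$, $p_2=(a_2:b_2)$ be distinct points of $\mathbb{CP}^1$, and let $\Gamma$ be obtained from $\mathbb{CP}^1\times\mathbb{CP}^1$ by identifying $(p_1,t)\sim(t,p_2)$, $t\in\mathbb{CP}^1$. Let $f,f_1,f_2$ be linearly independent forms $\alpha z_1z_2+\beta z_1w_2+\gamma w_1z_2+\delta w_1w_2$ in $P=(z_1:w_1,z_2:w_2)$ with complex coefficients, with $f(p_1,t)$ not identically zero in $t$, such that for some $A\in\mathbb C^*$ and $c_1,c_2\in\mathbb C$, identically in $t$, $$f(p_1,t)=A\,f(t,p_2),\qquad \frac{f_i(p_1,t)}{f(p_1,t)}-\frac{f_i(t,p_2)}{f(t,p_2)}=c_i\quad(i=1,2).$$ Put $F_i=f_i/f$ and fix $\Lambda\in\mathbb C$. Let $q=(x_0,y_0)\in\mathbb C^2$ (for instance $q=0$), let $\mathcal O$ be the ring of germs at $q$ of analytic functions of $(x,y)$, and let $\mathcal D=\mathcal O[\partial_x,\partial_y]$. For $n\ge 1$ let $M(n)$ be the $\mathcal O$-module of functions $$\psi(P,x,y)=\frac{\tilde f(P,x,y)}{f(P)^n}\,e^{xF_1(P)+yF_2(P)},\qquad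 \tilde f=\sum_{k,l=0}^n z_1^kw_1^{n-k}z_2^lw_2^{n-l}f_{kl}(x,y),\quad f_{kl}\in\mathcal O,$$ which satisfy $\psi(p_1,t,x,y)=\Lambda\,\psi(t,p_2,x,y)$ for all $t$ with $f(p_1,t)\neq0$, and let $M=\bigcup_{n\ge1}M(n)$, which is a $\mathcal D$-module (the Baker–Akhiezer module). **Theorem 2.** There exist $\psi_1,\psi_2\in M(1)$ such that the functions $\psi_1(\cdot,x_0,y_0)$ and $\psi_2(\cdot,x_0,y_0)$ of $P$ are linearly independent over $\mathbb C$. Moreover, for all $\psi_1,\psi_2\in M(1)$: 1. If $\psi_1(\cdot,x_0,y_0),\psi_2(\cdot,x_0,y_0)$ are linearly independent over $\mathbb C$ and $\Lambda\ne e^{c_1x_0+c_2y_0}$, then for every $\varphi\in M$ there is a unique pair $d_1,d_2\in\mathcal D$ with $d_1\psi_1+d_2\psi_2=\varphi$; that is, $M$ is a free $\mathcal D$-module of rank $2$ with basis $\psi_1,\psi_2$. 2. If $\psi_1,\psi_2$ are only assumed linearly independent over $\mathcal O$ (and $\Lambda$ is arbitrary), then they are linearly independent over $\mathcal D$, and for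 every $\varphi\in M$ there are $g\in\mathcal O$, $g\neq0$, and $d_1,d_2\in\mathcal D$ with $d_1\psi_1+d_2\psi_2=g\varphi$; that is, the same holds with operators having meromorphic coefficients. -/

import Mathlib

open Filter Topology

noncomputable section

namespace BakerAkhiezer

/-! ### Germs of analytic functions of two variables and differential operators -/

/-- The germs at `q` of all functions of `(x, y)` form a `ℂ`-algebra under pointwise operations. -/
instance germAlgebra (q : ℂ × ℂ) : Algebra ℂ (Germ (𝓝 q) ℂ) :=
  Algebra.ofModule
    (fun r x y => by
      induction x using Germ.inductionOn with | _ F => ?_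
      induction y using Germ.inductionOn with | _ G => ?_
      rw [← Germ.coe_smul, ← Germ.coe_mul, ← Germ.coe_mul, ← Germ.coe_smul, smul_mul_assoc])
    (fun r x y => by
      induction x using Germ.inductionOn with | _ F => ?_
      induction y using Germ.inductionOn with | _ G => ?_
      rw [← Germ.coe_smul, ← Germ.coe_mul, ← Germ.coe_mul, ← Germ.coe_smul, mul_smul_comm])

/-- The ring `𝒪` of (germs of) analytic functions of `(x, y)` in a neighbourhood of `q`. -/
def analyticGerms (q : ℂ × ℂ) : Subalgebra ℂ (Germ (𝓝 q) ℂ) where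
  carrier := {g | ∃ F : ℂ × ℂ → ℂ, AnalyticAt ℂ F q ∧ g = (F : Germ (𝓝 q) ℂ)}
  mul_mem' := by
    rintro _ _ ⟨F, hF, rfl⟩ ⟨G, hG, rfl⟩
    exact ⟨F * G, hF.mul hG, rfl⟩
  add_mem' := by
    rintro _ _ ⟨F, hF, rfl⟩ ⟨G, hG, rfl⟩
    exact ⟨F + G, hF.add hG, rfl⟩
  algebraMap_mem' := by
    intro r
    refine ⟨r • (1 : ℂ × ℂ → ℂ), (analyticAt_const (v := r • (1 : ℂ))).congr
      (Eventually.of_forall fun _ => rfl), ?_⟩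
    rw [Algebra.algebraMap_eq_smul_one, Germ.coe_smul, Germ.coe_one]

/-- Abbreviation for the ring `𝒪` at the base point `q`. -/
abbrev Oan (q : ℂ × ℂ) : Type := analyticGerms q

/-- The derivative of a germ in the direction `v`. -/
def germDeriv (q v : ℂ × ℂ) : Germ (𝓝 q) ℂ → Germ (𝓝 q) ℂ :=
  Quotient.map' (fun (F : ℂ × ℂ → ℂ) (p : ℂ × ℂ) => fderiv ℂ F p v)
    (fun F G (h : F =ᶠ[𝓝 q] G) => (h.fderiv (𝕜 := ℂ)).mono
      fun _ hp => congrArg (fun T : ℂ × ℂ →L[ℂ] ℂ => T v) hp)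

theorem germDeriv_coe (q v : ℂ × ℂ) (F : ℂ × ℂ → ℂ) :
    germDeriv q v (F : Germ (𝓝 q) ℂ) = ((fun p => fderiv ℂ F p v : ℂ × ℂ → ℂ) : Germ (𝓝 q) ℂ) :=
  rfl

theorem germDeriv_mem (q v : ℂ × ℂ) (g : Oan q) :
    germDeriv q v g ∈ analyticGerms q := by
  obtain ⟨_, F, hF, rfl⟩ := g
  exact ⟨fun p => fderiv ℂ F p v, ((ContinuousLinearMap.apply ℂ ℂ v).analyticAt _).comp hF.fderiv, rfl⟩

theorem germDeriv_add (q v : ℂ × ℂ) (g h : Oan q) :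
    germDeriv q v ((g : Germ (𝓝 q) ℂ) + h) = germDeriv q v g + germDeriv q v h := by
  obtain ⟨_, F, hF, rfl⟩ := g
  obtain ⟨_, G, hG, rfl⟩ := h
  change germDeriv q v ((F + G : ℂ × ℂ → ℂ) : Germ (𝓝 q) ℂ) = _
  refine Germ.coe_eq.2 ?_
  filter_upwards [hF.eventually_analyticAt, hG.eventually_analyticAt] with p hp hp'
  rw [fderiv_add hp.differentiableAt hp'.differentiableAt]
  rfl

theorem germDeriv_mul (q v : ℂ × ℂ) (g h : Oan q) :
    germDeriv q v ((g : Germ (𝓝 q) ℂ) * h) = g * germDeriv q v h + h * germDeriv q v g := by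
  obtain ⟨_, F, hF, rfl⟩ := g
  obtain ⟨_, G, hG, rfl⟩ := h
  change germDeriv q v ((F * G : ℂ × ℂ → ℂ) : Germ (𝓝 q) ℂ) = _
  refine Germ.coe_eq.2 ?_
  filter_upwards [hF.eventually_analyticAt, hG.eventually_analyticAt] with p hp hp'
  rw [fderiv_mul hp.differentiableAt hp'.differentiableAt]
  rfl

theorem germDeriv_smul (q v : ℂ × ℂ) (r : ℂ) (g : Oan q) :
    germDeriv q v (r • (g : Germ (𝓝 q) ℂ)) = r • germDeriv q v g := by
  obtain ⟨_, F, hF, rfl⟩ := g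
  change germDeriv q v ((r • F : ℂ × ℂ → ℂ) : Germ (𝓝 q) ℂ) = _
  refine Germ.coe_eq.2 ?_
  filter_upwards [hF.eventually_analyticAt] with p hp
  rw [fderiv_const_smul hp.differentiableAt r]
  rfl

/-- The derivation of `𝒪` given by differentiation in the direction `v`; thus
`partialD q (1, 0)` is `∂ₓ` and `partialD q (0, 1)` is `∂_y`. -/
def partialD (q v : ℂ × ℂ) : Derivation ℂ (Oan q) (Oan q) :=
  Derivation.mk'
    { toFun := fun g => ⟨germDeriv q v g, germDeriv_mem q v g⟩
      map_add' := fun g h => Subtype.ext (germDeriv_add q v g h)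
      map_smul' := fun r g => Subtype.ext (germDeriv_smul q v r g) }
    (fun g h => Subtype.ext (germDeriv_mul q v g h))

/-- The ring `𝒟 = 𝒪[∂ₓ, ∂_y]` of linear differential operators with coefficients in `𝒪`: the
`ℂ`-algebra of operators on `𝒪` generated by the multiplications by elements of `𝒪` and by the two
partial derivatives. -/
def diffOps (q : ℂ × ℂ) : Subalgebra ℂ (Module.End ℂ (Oan q)) :=
  Algebra.adjoin ℂ (Set.range (fun g : Oan q => LinearMap.mulLeft ℂ g) ∪
    {(partialD q (1, 0) : Oan q →ₗ[ℂ] Oan q), (partialD q (0, 1) : Oan q →ₗ[ℂ] Oan q)})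

/-- Abbreviation for the ring `𝒟` at the base point `q`. -/
abbrev Dops (q : ℂ × ℂ) : Type := diffOps q

/-- The germ at `q` of `(x, y) ↦ exp (x a + y b)`. -/
def expGerm (q : ℂ × ℂ) (a b : ℂ) : Oan q :=
  ⟨((fun p => Complex.exp (p.1 * a + p.2 * b) : ℂ × ℂ → ℂ) : Germ (𝓝 q) ℂ),
    _, ((analyticAt_fst.mul analyticAt_const).add (analyticAt_snd.mul analyticAt_const)).cexp, rfl⟩

theorem partialD_expGerm (q v : ℂ × ℂ) (a b : ℂ) :
    partialD q v (expGerm q a b) = (v.1 * a + v.2 * b) • expGerm q a b := by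
  apply Subtype.ext
  change ((fun p => fderiv ℂ (fun p : ℂ × ℂ => Complex.exp (p.1 * a + p.2 * b)) p v :
    ℂ × ℂ → ℂ) : Germ (𝓝 q) ℂ) = (((v.1 * a + v.2 * b) •
      fun p => Complex.exp (p.1 * a + p.2 * b) : ℂ × ℂ → ℂ) : Germ (𝓝 q) ℂ)
  refine Germ.coe_eq.2 (Eventually.of_forall fun p => ?_)
  have h1 : HasFDerivAt (fun p : ℂ × ℂ => p.1 * a + p.2 * b)
      (a • ContinuousLinearMap.fst ℂ ℂ ℂ + b • ContinuousLinearMap.snd ℂ ℂ ℂ) p :=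
    ((hasFDerivAt_fst (p := p)).mul_const a).add ((hasFDerivAt_snd (p := p)).mul_const b)
  have h2 := h1.cexp.fderiv
  change fderiv ℂ (fun p : ℂ × ℂ => Complex.exp (p.1 * a + p.2 * b)) p v
    = (v.1 * a + v.2 * b) • Complex.exp (p.1 * a + p.2 * b)
  rw [h2]
  simp
  ring

/-! ### Bihomogeneous forms -/

/-- The form `α z₁z₂ + β z₁w₂ + γ w₁z₂ + δ w₁w₂` with coefficient matrix `(α, β; γ, δ)`, at
`u = (z₁, w₁)`, `v = (z₂, w₂)`. -/
def biform (B : Matrix (Fin 2) (Fin 2) ℂ) (u v : Fin 2 → ℂ) : ℂ :=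
  B 0 0 * u 0 * v 0 + B 0 1 * u 0 * v 1 + B 1 0 * u 1 * v 0 + B 1 1 * u 1 * v 1

/-- The form `∑_{k,l=0}^n z₁^k w₁^(n-k) z₂^l w₂^(n-l) f_{kl}(x, y)` of bidegree `(n, n)` with
coefficients in `𝒪`, at `u = (z₁, w₁)`, `v = (z₂, w₂)`. -/
def form {q : ℂ × ℂ} (n : ℕ) (c : ℕ → ℕ → Oan q) (u v : Fin 2 → ℂ) : Oan q :=
  ∑ k ∈ Finset.range (n + 1), ∑ l ∈ Finset.range (n + 1),
    (u 0 ^ k * u 1 ^ (n - k) * v 0 ^ l * v 1 ^ (n - l)) • c k l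

theorem form_add {q : ℂ × ℂ} (n : ℕ) (c c' : ℕ → ℕ → Oan q) (u v : Fin 2 → ℂ) :
    form n (c + c') u v = form n c u v + form n c' u v := by
  simp [form, Finset.sum_add_distrib]

theorem form_mul {q : ℂ × ℂ} (n : ℕ) (g : Oan q) (c : ℕ → ℕ → Oan q) (u v : Fin 2 → ℂ) :
    form n (fun k l => g * c k l) u v = g * form n c u v := by
  simp [form, Finset.mul_sum]

theorem form_single {q : ℂ × ℂ} (n : ℕ) {k l : ℕ} (hk : k ≤ n) (hl : l ≤ n) (g : Oan q) :
    ∃ c : ℕ → ℕ → Oan q, ∀ u v : Fin 2 → ℂ,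
      form n c u v = (u 0 ^ k * u 1 ^ (n - k) * v 0 ^ l * v 1 ^ (n - l)) • g := by
  refine ⟨fun k' l' => if k' = k then (if l' = l then g else 0) else 0, fun u v => ?_⟩
  unfold form
  rw [Finset.sum_eq_single k, Finset.sum_eq_single l]
  · simp
  · intro b _ hb; simp [hb]
  · intro h; exact absurd (Finset.mem_range.2 (Nat.lt_succ_of_le hl)) h
  · intro b _ hb; simp [hb]
  · intro h; exact absurd (Finset.mem_range.2 (Nat.lt_succ_of_le hk)) h

theorem form_sum {q : ℂ × ℂ} (n : ℕ) (s : Finset ℕ) (G : ℕ → (Fin 2 → ℂ) → (Fin 2 → ℂ) → Oan q)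
    (h : ∀ i ∈ s, ∃ c : ℕ → ℕ → Oan q, ∀ u v, form n c u v = G i u v) :
    ∃ c : ℕ → ℕ → Oan q, ∀ u v, form n c u v = ∑ i ∈ s, G i u v := by
  classical
  induction s using Finset.induction_on with
  | empty => exact ⟨0, fun u v => by simp [form]⟩
  | insert a s ha ih =>
    obtain ⟨c, hc⟩ := ih fun i hi => h i (Finset.mem_insert_of_mem hi)
    obtain ⟨c', hc'⟩ := h a (Finset.mem_insert_self a s)
    exact ⟨c' + c, fun u v => by rw [form_add, hc, hc', Finset.sum_insert ha]⟩

/-- A form of bidegree `(1, 1)` times a form of bidegree `(n, n)` is a form of bidegree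
`(n + 1, n + 1)`. -/
theorem form_biform {q : ℂ × ℂ} (n : ℕ) (B : Matrix (Fin 2) (Fin 2) ℂ) (c : ℕ → ℕ → Oan q) :
    ∃ c' : ℕ → ℕ → Oan q, ∀ u v, form (n + 1) c' u v = biform B u v • form n c u v := by
  simp only [form.eq_1 n c, Finset.smul_sum]
  refine form_sum _ _ _ fun k hk => form_sum _ _ _ fun l hl => ?_
  have hk' : k ≤ n := Nat.lt_succ_iff.1 (Finset.mem_range.1 hk)
  have hl' : l ≤ n := Nat.lt_succ_iff.1 (Finset.mem_range.1 hl)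
  obtain ⟨c1, h1⟩ := form_single (n + 1) (Nat.succ_le_succ hk') (Nat.succ_le_succ hl')
    (B 0 0 • c k l)
  obtain ⟨c2, h2⟩ := form_single (n + 1) (Nat.succ_le_succ hk') (Nat.le_succ_of_le hl')
    (B 0 1 • c k l)
  obtain ⟨c3, h3⟩ := form_single (n + 1) (Nat.le_succ_of_le hk') (Nat.succ_le_succ hl')
    (B 1 0 • c k l)
  obtain ⟨c4, h4⟩ := form_single (n + 1) (Nat.le_succ_of_le hk') (Nat.le_succ_of_le hl')
    (B 1 1 • c k l)
  refine ⟨c1 + c2 + c3 + c4, fun u v => ?_⟩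
  rw [form_add, form_add, form_add, h1, h2, h3, h4, Nat.succ_sub hk', Nat.succ_sub hl']
  simp only [smul_smul, ← add_smul, biform, Nat.succ_eq_add_one, Nat.add_sub_add_right, pow_succ]
  congr 1
  ring

theorem form_partialD {q : ℂ × ℂ} (v : ℂ × ℂ) (n : ℕ) (c : ℕ → ℕ → Oan q) (u w : Fin 2 → ℂ) :
    partialD q v (form n c u w) = form n (fun k l => partialD q v (c k l)) u w := by
  simp [form]

/-! ### The spectral data and the Baker–Akhiezer module -/

/-- The data that determine the glued surface `Γ` and the module on it. A point of `ℂP¹` is given by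
homogeneous coordinates `(z : w)`, that is, by a vector of `ℂ²`. -/
structure SpectralData where
  /-- homogeneous coordinates `(a₁ : b₁)` of the first point -/
  p₁ : Fin 2 → ℂ
  /-- homogeneous coordinates `(a₂ : b₂)` of the second point -/
  p₂ : Fin 2 → ℂ
  /-- `p₁`, `p₂` are distinct points of `ℂP¹` -/
  p_ne : p₁ 0 * p₂ 1 - p₁ 1 * p₂ 0 ≠ 0
  /-- the coefficients of the form `f` -/
  f : Matrix (Fin 2) (Fin 2) ℂ
  /-- the coefficients of the form `f₁` -/
  f₁ : Matrix (Fin 2) (Fin 2) ℂ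
  /-- the coefficients of the form `f₂` -/
  f₂ : Matrix (Fin 2) (Fin 2) ℂ
  /-- the multiplier of `f` -/
  A : ℂ
  A_ne : A ≠ 0
  /-- `f` is compatible with the identification `(p₁, t) ∼ (t, p₂)` -/
  f_glue : ∀ t, biform f p₁ t - A * biform f t p₂ = 0
  /-- `f` does not vanish identically on the glued lines -/
  f_line : ∃ t, biform f p₁ t ≠ 0
  /-- the increment of `F₁ = f₁ / f` -/
  c₁ : ℂ
  /-- the increment of `F₂ = f₂ / f` -/
  c₂ : ℂ
  f₁_glue : ∀ t, biform f p₁ t ≠ 0 →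
    biform f₁ p₁ t / biform f p₁ t - biform f₁ t p₂ / biform f t p₂ - c₁ = 0
  f₂_glue : ∀ t, biform f p₁ t ≠ 0 →
    biform f₂ p₁ t / biform f p₁ t - biform f₂ t p₂ / biform f t p₂ - c₂ = 0
  indep : LinearIndependent ℂ ![f₁, f₂, f]
  /-- the multiplier of the functions of the module -/
  Λ : ℂ

namespace SpectralData

variable (X : SpectralData) (q : ℂ × ℂ)

/-- The (homogeneous coordinates of) points `P = (z₁ : w₁, z₂ : w₂)` of `ℂP¹ × ℂP¹` off the curve
`f = 0`. -/
abbrev Pt : Type := {P : (Fin 2 → ℂ) × (Fin 2 → ℂ) // biform X.f P.1 P.2 ≠ 0}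

/-- The function `F₁ = f₁ / f`. -/
def F₁ (P : X.Pt) : ℂ := biform X.f₁ P.1.1 P.1.2 / biform X.f P.1.1 P.1.2

/-- The function `F₂ = f₂ / f`. -/
def F₂ (P : X.Pt) : ℂ := biform X.f₂ P.1.1 P.1.2 / biform X.f P.1.1 P.1.2

/-- The identity `ψ(p₁, t, x, y) - Λ ψ(t, p₂, x, y) = 0` at all `t` where both sides are defined. -/
def Glued {q : ℂ × ℂ} (ψ : X.Pt → Oan q) : Prop :=
  ∀ (t : Fin 2 → ℂ) (h₁ : biform X.f X.p₁ t ≠ 0) (h₂ : biform X.f t X.p₂ ≠ 0),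
    ψ ⟨(X.p₁, t), h₁⟩ - X.Λ • ψ ⟨(t, X.p₂), h₂⟩ = 0

/-- `ψ(P, x, y) = f̃(P, x, y) / f(P)^n * exp (x F₁(P) + y F₂(P))`, where `f̃` is a form of bidegree
`(n, n)` in `P` with coefficients in `𝒪`. All functions here are homogeneous of degree zero in
either pair of homogeneous coordinates of `P`. -/
def HasForm {q : ℂ × ℂ} (n : ℕ) (ψ : X.Pt → Oan q) : Prop :=
  ∃ c : ℕ → ℕ → Oan q, ∀ P : X.Pt,
    ψ P = (1 / biform X.f P.1.1 P.1.2 ^ n) • form n c P.1.1 P.1.2 * expGerm q (X.F₁ P) (X.F₂ P)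

/-- The `𝒪`-module `M(n)`. -/
def level (n : ℕ) : Submodule (Oan q) (X.Pt → Oan q) where
  carrier := {ψ | X.HasForm n ψ ∧ X.Glued ψ}
  zero_mem' := ⟨⟨0, fun P => by simp [form]⟩, fun t h₁ h₂ => by simp⟩
  add_mem' := by
    rintro ψ φ ⟨⟨c, hc⟩, hψ⟩ ⟨⟨c', hc'⟩, hφ⟩
    refine ⟨⟨c + c', fun P => ?_⟩, fun t h₁ h₂ => ?_⟩
    · rw [Pi.add_apply, hc, hc', form_add, smul_add, add_mul]
    · have e1 := hψ t h₁ h₂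
      have e2 := hφ t h₁ h₂
      rw [sub_eq_zero] at e1 e2
      rw [Pi.add_apply, Pi.add_apply, e1, e2, smul_add, sub_self]
  smul_mem' := by
    rintro g ψ ⟨⟨c, hc⟩, hψ⟩
    refine ⟨⟨fun k l => g * c k l, fun P => ?_⟩, fun t h₁ h₂ => ?_⟩
    · rw [Pi.smul_apply, hc, form_mul, smul_eq_mul, ← mul_assoc, mul_smul_comm]
    · have e1 := hψ t h₁ h₂
      rw [sub_eq_zero] at e1
      rw [Pi.smul_apply, Pi.smul_apply, e1, smul_eq_mul, smul_eq_mul, mul_smul_comm, sub_self]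

variable {X q}

theorem level_succ {n : ℕ} {ψ : X.Pt → Oan q} (h : ψ ∈ X.level q n) : ψ ∈ X.level q (n + 1) := by
  obtain ⟨⟨c, hc⟩, hψ⟩ := h
  obtain ⟨c', hc'⟩ := form_biform n X.f c
  refine ⟨⟨c', fun P => ?_⟩, hψ⟩
  rw [hc, hc', smul_smul]
  congr 2
  have := P.2
  rw [pow_succ]
  field_simp

theorem level_mono {m n : ℕ} (hmn : m ≤ n) {ψ : X.Pt → Oan q} (h : ψ ∈ X.level q m) :
    ψ ∈ X.level q n := by
  induction n, hmn using Nat.le_induction with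
  | base => exact h
  | succ n _ ih => exact level_succ ih

theorem glued_end {ψ : X.Pt → Oan q} (h : X.Glued ψ) (d : Module.End ℂ (Oan q)) :
    X.Glued (fun P => d (ψ P)) := by
  intro t h₁ h₂
  have e := congrArg d (h t h₁ h₂)
  simpa using e

theorem level_partialD (v : ℂ × ℂ) {n : ℕ} {ψ : X.Pt → Oan q} (h : ψ ∈ X.level q n) :
    (fun P => partialD q v (ψ P)) ∈ X.level q (n + 1) := by
  obtain ⟨⟨c, hc⟩, hψ⟩ := h
  refine ⟨?_, glued_end hψ (partialD q v : Oan q →ₗ[ℂ] Oan q)⟩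
  obtain ⟨c₀, h₀⟩ := form_biform n X.f (fun k l => partialD q v (c k l))
  obtain ⟨c₁, h₁⟩ := form_biform n (v.1 • X.f₁ + v.2 • X.f₂) c
  refine ⟨c₀ + c₁, fun P => ?_⟩
  have hP := P.2
  have hB : biform (v.1 • X.f₁ + v.2 • X.f₂) P.1.1 P.1.2
      = (v.1 * X.F₁ P + v.2 * X.F₂ P) * biform X.f P.1.1 P.1.2 := by
    have : biform (v.1 • X.f₁ + v.2 • X.f₂) P.1.1 P.1.2
        = v.1 * biform X.f₁ P.1.1 P.1.2 + v.2 * biform X.f₂ P.1.1 P.1.2 := by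
      simp only [biform, Matrix.add_apply, Matrix.smul_apply, smul_eq_mul]; ring
    rw [this, F₁, F₂]
    field_simp
  change partialD q v (ψ P) = _
  rw [hc, form_add, h₀, h₁, hB, Derivation.leibniz, partialD_expGerm, Derivation.map_smul, form_partialD,
    smul_add, smul_smul, smul_smul]
  have e1 : 1 / biform X.f P.1.1 P.1.2 ^ (n + 1) * biform X.f P.1.1 P.1.2
      = 1 / biform X.f P.1.1 P.1.2 ^ n := by
    rw [pow_succ]
    field_simp
  rw [mul_comm (v.1 * X.F₁ P + v.2 * X.F₂ P) (biform X.f P.1.1 P.1.2), ← mul_assoc, e1, add_mul,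
    add_comm]
  simp only [smul_eq_mul, mul_smul_comm, smul_mul_assoc, smul_smul]
  congr 1
  · rw [mul_comm]
  · rw [mul_comm (v.1 * X.F₁ P + v.2 * X.F₂ P)]

variable (X q)

/-- The Baker–Akhiezer module `M = ⋃_{n ≥ 1} M(n)`, a module over `𝒟 = 𝒪[∂ₓ, ∂_y]`, whose elements
act on a function `ψ(P, x, y)` through the variables `x, y`. -/
def baModule : Submodule (Dops q) (X.Pt → Oan q) where
  carrier := ⋃ n : ℕ, ⋃ _ : 1 ≤ n, (X.level q n : Set (X.Pt → Oan q))
  zero_mem' := by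
    simp only [Set.mem_iUnion]
    exact ⟨1, le_rfl, (X.level q 1).zero_mem⟩
  add_mem' := by
    intro ψ φ hψ hφ
    simp only [Set.mem_iUnion] at hψ hφ ⊢
    obtain ⟨m, hm, hψ⟩ := hψ
    obtain ⟨n, hn, hφ⟩ := hφ
    exact ⟨m + n, by omega, (X.level q (m + n)).add_mem (level_mono (by omega) hψ)
      (level_mono (by omega) hφ)⟩
  smul_mem' := by
    rintro ⟨d, hd⟩ ψ hψ
    simp only [Set.mem_iUnion] at hψ ⊢
    change ∃ n, ∃ _ : 1 ≤ n, (fun P => d (ψ P)) ∈ X.level q n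
    change ∃ n, ∃ _ : 1 ≤ n, ψ ∈ X.level q n at hψ
    revert ψ
    induction hd using Algebra.adjoin_induction with
    | mem d hd =>
      intro ψ hψ
      obtain ⟨n, hn, hψ⟩ := hψ
      rcases hd with ⟨g, rfl⟩ | rfl | rfl
      · exact ⟨n, hn, (X.level q n).smul_mem g hψ⟩
      · exact ⟨n + 1, by omega, level_partialD (1, 0) hψ⟩
      · exact ⟨n + 1, by omega, level_partialD (0, 1) hψ⟩
    | algebraMap r =>
      intro ψ hψ
      obtain ⟨n, hn, hψ⟩ := hψ
      refine ⟨n, hn, ?_⟩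
      have e : (fun P => (algebraMap ℂ (Module.End ℂ (Oan q)) r) (ψ P))
          = (algebraMap ℂ (Oan q) r) • ψ := by
        funext P
        rw [Pi.smul_apply, algebraMap_smul]
        rfl
      rw [e]
      exact (X.level q n).smul_mem _ hψ
    | add d d' _ _ ih ih' =>
      intro ψ hψ
      obtain ⟨m, hm, h⟩ := ih hψ
      obtain ⟨n, hn, h'⟩ := ih' hψ
      exact ⟨m + n, by omega, (X.level q (m + n)).add_mem (level_mono (by omega) h)
        (level_mono (by omega) h')⟩
    | mul d d' _ _ ih ih' => exact fun {_} hψ => ih (ih' hψ)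

variable {X q}

/-- The function `P ↦ ψ(P, x₀, y₀)` obtained by fixing `(x, y)` at the base point
`q = (x₀, y₀)`. -/
def atBase (ψ : X.Pt → Oan q) : X.Pt → ℂ := fun P => (ψ P : Germ (𝓝 q) ℂ).value

end SpectralData

end BakerAkhiezer

end

/-! Take coordinates on `ℂ²` along `p₁` (rescaled by `A`) and `p₂`. The gluing of `f` fixes its
coefficients up to the scale `f₂₂` and one parameter `rho`, and the complement of `f = 0` becomes an
affine quadric with coordinates `fnH`, `fnK`, `fnE`: a double cover of the `(fnK, fnH)`-plane, with
`fnE` quadratic over it (`fn_relation`, `exists_point`). On the glued lines `fnH` vanishes, `fnK`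
jumps by one, and `fnE` takes the value of `fnK` to zero.

The increment conditions force each `Fᵢ` to be affine in `fnH` and `fnK`, and the linear
independence of the forms makes this change of coordinates invertible (`jac_ne_zero`). So suitable
combinations `opH`, `opK` of `∂ₓ`, `∂_y` and constants act on `exp (x F₁ + y F₂)` as multiplication
by `fnH` and `fnK`. Every operator is a polynomial in `opH`, `opK` with coefficients in `𝒪` on the
left, and acts on the exponential as its symbol. By the double cover, the functions of the required
form without gluing are exactly of the shape `a • exp + fnE (b • exp)` with unique operators `a`,
`b` (`mem_opSpan_of_hasForm`, `eq_zero_of_smul_expFn_add`).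

Now impose the gluing, with `gap = 1 - Λ exp (-c₁ x - c₂ y)`. At level one it leaves the `𝒪`-span of
`genG = (1 - gap fnK + gap² fnE) exp` and `genH = fnH exp`. For general `φ`, the Ore condition lets
a multiple of `genG` cancel the `fnE` part after multiplication by a power of `gap`. What remains is
a polynomial in `fnK`, `fnH` times `exp`; at `fnH = 0` the gluing becomes a shift equation `exp (c₁
x + c₂ y) p(τ + 1) = Λ p(τ)`, whose only solution is zero, so the remainder is divisible by `fnH`
and is a multiple of `genH` (`exists_smul_genH`). Hence `genG`, `genH` are independent over `𝒟` and
generate up to powers of `gap`.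

Any other pair in `M(1)` is related to this one by a matrix over `𝒪`. Its determinant and `gap` are
the only obstructions (`exists_pow_smul_eq`): under the first hypotheses both are units of `𝒪`,
under the second both are merely nonzero. -/

noncomputable section

namespace BakerAkhiezer

/-! ### The ring of analytic germs -/

section Germs

variable {q : ℂ × ℂ}

/-- The identity theorem: if `F` is nonzero at one point of a small ball, then `G` vanishes near
that point and so on the whole ball. -/
instance analyticGerms_noZeroDivisors : NoZeroDivisors (Oan q) where
  eq_zero_or_eq_zero_of_mul_eq_zero := by
    rintro ⟨_, F, hF, rfl⟩ ⟨_, G, hG, rfl⟩ h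
    have h0 : F * G =ᶠ[𝓝 q] 0 := Germ.coe_eq.1 (congrArg Subtype.val h)
    rw [or_iff_not_imp_left]
    intro hF0
    have hF0' : ¬ F =ᶠ[𝓝 q] 0 := fun e => hF0 (Subtype.ext (Germ.coe_eq.2 e))
    obtain ⟨r, hr, hball⟩ := Metric.eventually_nhds_iff_ball.1
      ((hF.eventually_analyticAt.and hG.eventually_analyticAt).and h0)
    have hex : ∃ p ∈ Metric.ball q r, F p ≠ 0 := by
      by_contra! hcon
      exact hF0' (Metric.eventually_nhds_iff_ball.2 ⟨r, hr, hcon⟩)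
    obtain ⟨p, hp, hFp⟩ := hex
    have hGp : G =ᶠ[𝓝 p] 0 := by
      filter_upwards [(hball p hp).1.1.continuousAt.eventually_ne hFp,
        Metric.isOpen_ball.mem_nhds hp] with z hz hz'
      exact (mul_eq_zero.1 (hball z hz').2).resolve_left hz
    have hEq : Set.EqOn G 0 (Metric.ball q r) :=
      AnalyticOnNhd.eqOn_of_preconnected_of_eventuallyEq (𝕜 := ℂ) (fun z hz => (hball z hz).1.2)
        (fun z _ => analyticAt_const) (convex_ball q r).isPreconnected hp hGp
    exact Subtype.ext (Germ.coe_eq.2 (Metric.eventually_nhds_iff_ball.2 ⟨r, hr, hEq⟩))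

/-- The value of a germ at the base point, as a ring homomorphism. -/
def valueHom (q : ℂ × ℂ) : Oan q →+* ℂ :=
  Germ.valueRingHom.comp (analyticGerms q).val.toRingHom

theorem valueHom_smul (r : ℂ) (g : Oan q) : valueHom q (r • g) = r * valueHom q g := by
  obtain ⟨_, F, hF, rfl⟩ := g
  rfl

theorem valueHom_expGerm (a b : ℂ) :
    valueHom q (expGerm q a b) = Complex.exp (q.1 * a + q.2 * b) := rfl

instance analyticGerms_nontrivial : Nontrivial (Oan q) := (valueHom q).domain_nontrivial

instance analyticGerms_isDomain : IsDomain (Oan q) := NoZeroDivisors.to_isDomain _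

theorem isUnit_of_valueHom_ne_zero {g : Oan q} (hg : valueHom q g ≠ 0) : IsUnit g := by
  obtain ⟨_, F, hF, rfl⟩ := g
  have hF0 : F q ≠ 0 := hg
  refine IsUnit.of_mul_eq_one (⟨_, F⁻¹, hF.inv hF0, rfl⟩ : Oan q) (Subtype.ext ?_)
  refine Germ.coe_eq.2 ?_
  filter_upwards [hF.continuousAt.eventually_ne hF0] with z hz
  exact mul_inv_cancel₀ hz

theorem expGerm_mul (a b a' b' : ℂ) :
    expGerm q a b * expGerm q a' b' = expGerm q (a + a') (b + b') := by
  refine Subtype.ext (Germ.coe_eq.2 (Eventually.of_forall fun p => ?_))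
  change Complex.exp _ * Complex.exp _ = Complex.exp _
  rw [← Complex.exp_add]
  ring_nf

theorem expGerm_zero : expGerm q 0 0 = 1 := by
  refine Subtype.ext (Germ.coe_eq.2 (Eventually.of_forall fun p => ?_))
  change Complex.exp _ = 1
  simp

theorem expGerm_neg_mul (a b : ℂ) : expGerm q (-a) (-b) * expGerm q a b = 1 := by
  rw [expGerm_mul, neg_add_cancel, neg_add_cancel, expGerm_zero]

theorem partialD_comm (v w : ℂ × ℂ) (g : Oan q) :
    partialD q v (partialD q w g) = partialD q w (partialD q v g) := by
  obtain ⟨_, F, hF, rfl⟩ := g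
  apply Subtype.ext
  change ((fun p => fderiv ℂ (fun p' => fderiv ℂ F p' w) p v : ℂ × ℂ → ℂ) : Germ (𝓝 q) ℂ)
    = ((fun p => fderiv ℂ (fun p' => fderiv ℂ F p' v) p w : ℂ × ℂ → ℂ) : Germ (𝓝 q) ℂ)
  refine Germ.coe_eq.2 ?_
  filter_upwards [hF.eventually_analyticAt] with p hp
  have hd : DifferentiableAt ℂ (fderiv ℂ F) p := hp.fderiv.differentiableAt
  have hs : IsSymmSndFDerivAt ℂ F p :=
    (hp.contDiffAt (n := 2)).isSymmSndFDerivAt (by simp)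
  have key (a b : ℂ × ℂ) : fderiv ℂ (fun p' => fderiv ℂ F p' a) p b
      = fderiv ℂ (fderiv ℂ F) p b a := by
    rw [fderiv_clm_apply hd (differentiableAt_const a)]
    simp
  rw [key, key]
  exact hs v w

theorem partialD_eq (v : ℂ × ℂ) (g : Oan q) :
    partialD q v g = v.1 • partialD q (1, 0) g + v.2 • partialD q (0, 1) g := by
  obtain ⟨_, F, hF, rfl⟩ := g
  refine Subtype.ext (Germ.coe_eq.2 (Eventually.of_forall fun p => ?_))
  change fderiv ℂ F p v = v.1 • fderiv ℂ F p (1, 0) + v.2 • fderiv ℂ F p (0, 1)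
  rw [← map_smul, ← map_smul, ← map_add]
  simp

/-- The germ of the linear function `a x + b y`. -/
def linGerm (q : ℂ × ℂ) (a b : ℂ) : Oan q :=
  ⟨((fun p => p.1 * a + p.2 * b : ℂ × ℂ → ℂ) : Germ (𝓝 q) ℂ),
    _, (analyticAt_fst.mul analyticAt_const).add (analyticAt_snd.mul analyticAt_const), rfl⟩

theorem partialD_linGerm (v : ℂ × ℂ) (a b : ℂ) :
    partialD q v (linGerm q a b) = algebraMap ℂ (Oan q) (v.1 * a + v.2 * b) := by
  rw [Algebra.algebraMap_eq_smul_one]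
  refine Subtype.ext (Germ.coe_eq.2 (Eventually.of_forall fun p => ?_))
  have h1 : HasFDerivAt (fun p : ℂ × ℂ => p.1 * a + p.2 * b)
      (a • ContinuousLinearMap.fst ℂ ℂ ℂ + b • ContinuousLinearMap.snd ℂ ℂ ℂ) p :=
    ((hasFDerivAt_fst (p := p)).mul_const a).add ((hasFDerivAt_snd (p := p)).mul_const b)
  change fderiv ℂ (fun p : ℂ × ℂ => p.1 * a + p.2 * b) p v = (v.1 * a + v.2 * b) • (1 : ℂ)
  rw [h1.fderiv]
  simp
  ring

end Germs

/-! ### Normal forms in rings of differential operators -/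

section NormalForm

open Polynomial

variable {R D : Type*} [CommRing R] [Ring D]

/-- The operator `∑ aᵢⱼ d'^j d^i` of the polynomial `∑ aᵢⱼ Y^j X^i` (`X` is the outer variable),
where `m a` is the operator of multiplication by `a`. -/
def opOfPoly (m : R →+* D) (d d' : D) : R[X][X] →+ D where
  toFun P := P.sum fun i p => eval₂ m d' p * d ^ i
  map_zero' := by simp
  map_add' P Q := by
    rw [sum_add_index]
    · simp
    · intro i a b; rw [eval₂_add, add_mul]

variable (m : R →+* D) (d d' : D)

theorem opOfPoly_monomial (i : ℕ) (p : R[X]) :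
    opOfPoly m d d' (monomial i p) = eval₂ m d' p * d ^ i :=
  sum_monomial_index p (fun i p => eval₂ m d' p * d ^ i) (by simp)

theorem opOfPoly_C (p : R[X]) : opOfPoly m d d' (C p) = eval₂ m d' p := by
  rw [← monomial_zero_left, opOfPoly_monomial, pow_zero, mul_one]

theorem opOfPoly_one : opOfPoly m d d' 1 = 1 := by
  rw [← C_1, opOfPoly_C, eval₂_one]

/-- An additive predicate on polynomials in two variables holds if it holds on monomials. -/
theorem opOfPoly_induction {p : R[X][X] → Prop} (hadd : ∀ P Q, p P → p Q → p (P + Q))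
    (hmon : ∀ i j a, p (monomial i (monomial j a))) (P : R[X][X]) : p P := by
  induction P using Polynomial.induction_on' with
  | add P Q hP hQ => exact hadd P Q hP hQ
  | monomial i w =>
    induction w using Polynomial.induction_on' with
    | add v w hv hw => rw [map_add]; exact hadd _ _ hv hw
    | monomial j a => exact hmon i j a

theorem opOfPoly_monomial_monomial (i j : ℕ) (a : R) :
    opOfPoly m d d' (monomial i (monomial j a)) = m a * d' ^ j * d ^ i := by
  rw [opOfPoly_monomial, eval₂_monomial]

theorem mul_opOfPoly_mem {e : D}
    (h : ∀ i j a, e * (m a * d' ^ j * d ^ i) ∈ AddMonoidHom.mrange (opOfPoly m d d')) (P : R[X][X]) :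
    e * opOfPoly m d d' P ∈ AddMonoidHom.mrange (opOfPoly m d d') := by
  induction P using opOfPoly_induction with
  | hadd P Q hP hQ => rw [map_add, mul_add]; exact add_mem hP hQ
  | hmon i j a => rw [opOfPoly_monomial_monomial]; exact h i j a

theorem monomial_mem_mrange (i j : ℕ) (a : R) :
    m a * d' ^ j * d ^ i ∈ AddMonoidHom.mrange (opOfPoly m d d') :=
  ⟨_, opOfPoly_monomial_monomial m d d' i j a⟩

theorem coeff_mul_opOfPoly_mem (a : R) (P : R[X][X]) :
    m a * opOfPoly m d d' P ∈ AddMonoidHom.mrange (opOfPoly m d d') :=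
  mul_opOfPoly_mem m d d' (fun i j b => by
    rw [← mul_assoc, ← mul_assoc, ← map_mul]; exact monomial_mem_mrange m d d' i j _) P

variable {m d d'}

theorem fst_mul_opOfPoly_mem (hc : Commute d d') {δ : R → R}
    (hδ : ∀ a, d * m a = m a * d + m (δ a)) (P : R[X][X]) :
    d * opOfPoly m d d' P ∈ AddMonoidHom.mrange (opOfPoly m d d') := by
  refine mul_opOfPoly_mem m d d' (fun i j a => ?_) P
  have : d * (m a * d' ^ j * d ^ i) = m a * d' ^ j * d ^ (i + 1) + m (δ a) * d' ^ j * d ^ i := by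
    rw [← mul_assoc, ← mul_assoc, hδ, add_mul, add_mul, mul_assoc (m a) d,
      (hc.pow_right j).eq, ← mul_assoc, mul_assoc _ d, ← pow_succ']
  rw [this]
  exact add_mem (monomial_mem_mrange m d d' _ _ _) (monomial_mem_mrange m d d' _ _ _)

theorem snd_mul_opOfPoly_mem {δ : R → R}
    (hδ : ∀ a, d' * m a = m a * d' + m (δ a)) (P : R[X][X]) :
    d' * opOfPoly m d d' P ∈ AddMonoidHom.mrange (opOfPoly m d d') := by
  refine mul_opOfPoly_mem m d d' (fun i j a => ?_) P
  have : d' * (m a * d' ^ j * d ^ i) = m a * d' ^ (j + 1) * d ^ i + m (δ a) * d' ^ j * d ^ i := by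
    rw [← mul_assoc, ← mul_assoc, hδ, add_mul, add_mul, mul_assoc (m a) d', ← pow_succ']
  rw [this]
  exact add_mem (monomial_mem_mrange m d d' _ _ _) (monomial_mem_mrange m d d' _ _ _)

/-! ### Commutators with dual coordinates, and right cancellation -/

theorem pow_mul_of_commutator {e y : D} (h : e * y = y * e + 1) (n : ℕ) :
    e ^ n * y = y * e ^ n + n * e ^ (n - 1) := by
  induction n with
  | zero => simp
  | succ n ih =>
    rw [pow_succ, mul_assoc, h, mul_add, mul_one, ← mul_assoc, ih, add_mul, mul_assoc,
      mul_assoc (n : D), add_tsub_cancel_right]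
    rcases n with _ | n
    · simp
    · rw [add_tsub_cancel_right, ← pow_succ]
      push_cast
      noncomm_ring

/-- Commuting with a coordinate dual to `d'` differentiates the symbol and so lowers its degree.
This drives the induction that cancels a germ on the right. -/
theorem eval₂_mul_of_commutator {y : R} (h : d' * m y = m y * d' + 1) (p : R[X]) :
    eval₂ m d' p * m y = m y * eval₂ m d' p + eval₂ m d' (derivative p) := by
  induction p using Polynomial.induction_on' with
  | add p q hp hq => simp only [derivative_add, eval₂_add, add_mul, mul_add, hp, hq]; abel
  | monomial j a =>
    rw [derivative_monomial, eval₂_monomial, eval₂_monomial, mul_assoc, pow_mul_of_commutator h,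
      mul_add, ← mul_assoc, ← map_mul, mul_comm a y, map_mul, map_mul, map_natCast, mul_assoc,
      mul_assoc (m a)]

theorem opOfPoly_mul_of_commutator {x : R} (h : d * m x = m x * d + 1)
    (h' : Commute d' (m x)) (P : R[X][X]) :
    opOfPoly m d d' P * m x = m x * opOfPoly m d d' P + opOfPoly m d d' (derivative P) := by
  induction P using opOfPoly_induction with
  | hadd P Q hP hQ => simp only [map_add, add_mul, mul_add, hP, hQ]; abel
  | hmon i j a =>
    have e : (monomial j a : R[X]) * (i : R[X]) = monomial j (a * i) := by
      rw [← C_eq_natCast, monomial_mul_C]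
    rw [derivative_monomial, e, opOfPoly_monomial_monomial, opOfPoly_monomial_monomial, mul_assoc,
      pow_mul_of_commutator h, mul_add, ← mul_assoc, mul_assoc (m a), (h'.pow_left j).eq,
      ← mul_assoc, ← map_mul, mul_comm a x, map_mul, map_mul, map_natCast, ← mul_assoc]
    congr 1
    · simp only [mul_assoc]
    · rw [mul_assoc (m a), ← (Nat.cast_commute i (d' ^ j)).eq, ← mul_assoc]

/-- Multiplication by a regular element can be cancelled on the right of an operator. -/
theorem opOfPoly_mul_eq_zero [CharZero R] [IsDomain R] (hm : Function.Injective m) {x y : R}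
    (hx : d * m x = m x * d + 1) (hx' : Commute d' (m x)) (hy : d' * m y = m y * d' + 1)
    {g : R} (hg : g ≠ 0) {P : R[X][X]} (h : opOfPoly m d d' P * m g = 0) : P = 0 := by
  -- Multiplications commute, so if `m g` kills `a` from the right, it also kills the commutator of
  -- `a` with any `m z`.
  have swap {a b : D} {z : R} (e : a * m z = m z * a + b) (h : a * m g = 0) : b * m g = 0 := by
    have hb : b = a * m z - m z * a := by rw [e, add_sub_cancel_left]
    rw [hb, sub_mul, mul_assoc, ← map_mul, mul_comm z g, map_mul, ← mul_assoc, h, mul_assoc, h]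
    simp
  have inner : ∀ n (p : R[X]), p.natDegree ≤ n → eval₂ m d' p * m g = 0 → p = 0 := by
    intro n
    induction n with
    | zero =>
      intro p hp h
      rw [eq_C_of_natDegree_le_zero hp, eval₂_C, ← map_mul] at h
      rw [eq_C_of_natDegree_le_zero hp,
        (mul_eq_zero.1 (hm (h.trans (map_zero m).symm))).resolve_right hg, C_0]
    | succ n ih =>
      intro p hp h
      -- The derivative satisfies the same equation in lower degree, so it vanishes; in
      -- characteristic zero `p` is then constant and the induction hypothesis applies to `p`
      -- itself.
      have hd : derivative p = 0 := ih _ ((natDegree_derivative_le p).trans (by omega))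
        (swap (eval₂_mul_of_commutator hy p) h)
      exact ih p ((derivative_eq_zero.1 hd).trans_le (Nat.zero_le n)) h
  have outer : ∀ n (P : R[X][X]), P.natDegree ≤ n → opOfPoly m d d' P * m g = 0 → P = 0 := by
    intro n
    induction n with
    | zero =>
      intro P hP h
      rw [eq_C_of_natDegree_le_zero hP, opOfPoly_C] at h
      rw [eq_C_of_natDegree_le_zero hP, inner _ _ le_rfl h, C_0]
    | succ n ih =>
      intro P hP h
      have hd : derivative P = 0 := ih _ ((natDegree_derivative_le P).trans (by omega))
        (swap (opOfPoly_mul_of_commutator hx hx' P) h)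
      exact ih P ((derivative_eq_zero.1 hd).trans_le (Nat.zero_le n)) h
  exact outer _ P le_rfl h

/-! ### Vanishing criteria for polynomials over a domain -/

/-- A polynomial in two variables that vanishes at all complex points is zero. -/
theorem eq_zero_of_evalEval_eq_zero [Algebra ℂ R] [IsDomain R] {P : R[X][X]}
    (h : ∀ a b : ℂ, P.evalEval (algebraMap ℂ R a) (algebraMap ℂ R b) = 0) : P = 0 := by
  have hinj : Function.Injective (algebraMap ℂ R) := (algebraMap ℂ R).injective
  refine eq_zero_of_infinite_isRoot P (Set.infinite_of_injective_forall_mem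
    (f := fun b : ℂ => (C (algebraMap ℂ R b) : R[X])) (C_injective.comp hinj) fun b => ?_)
  exact eq_zero_of_infinite_isRoot _ (Set.infinite_of_injective_forall_mem hinj fun a => h a b)

/-- The coordinate functions of a double cover of the plane generate freely: the functions `1` and
`e` on the surface `e² = e (k + r h - 1) + k h` are independent over polynomials in `k, h`. -/
theorem eq_zero_of_double_cover [Algebra ℂ R] [IsDomain R] {P Q : R[X][X]} (r : ℂ)
    (hPQ : ∀ k h e : ℂ, e * e = e * (k + r * h - 1) + k * h →
      P.evalEval (algebraMap ℂ R k) (algebraMap ℂ R h)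
        + e • Q.evalEval (algebraMap ℂ R k) (algebraMap ℂ R h) = 0) : P = 0 ∧ Q = 0 := by
  let ev (k h : ℂ) : R[X][X] →+* R := evalEvalRingHom (algebraMap ℂ R k) (algebraMap ℂ R h)
  have hpt (k h e : ℂ) (hr : e * e = e * (k + r * h - 1) + k * h) :
      ev k h P + e • ev k h Q = 0 := hPQ k h e hr
  have hroot (k h : ℂ) : ∃ w : ℂ, w ^ 2 = (k + r * h - 1) ^ 2 + 4 * (k * h) :=
    IsAlgClosed.exists_pow_nat_eq _ two_pos
  -- The discriminant of the quadratic equation for `e`; the outer variable is `h`, the inner one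
  -- `k`. It is not the zero polynomial, having value `1` at the origin.
  let disc : R[X][X] := (C X + C (C (algebraMap ℂ R r)) * X - 1) ^ 2 + 4 * (C X * X)
  have hdisc (k h : ℂ) : ev k h disc
      = algebraMap ℂ R ((k + r * h - 1) ^ 2 + 4 * (k * h)) := by
    have e4 : ev k h 4 = 4 := map_ofNat _ 4
    have e4' : algebraMap ℂ R 4 = 4 := map_ofNat _ 4
    have ex : ev k h (C X) = algebraMap ℂ R k := by simp [ev]
    have ey : ev k h X = algebraMap ℂ R h := by simp [ev]
    have ec (c : R) : ev k h (C (C c)) = c := by simp [ev]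
    simp only [disc, map_add, map_sub, map_mul, map_pow, map_one, e4, e4', ex, ey, ec]
  have hQ : Q = 0 := by
    have hprod : disc * Q = 0 := by
      refine eq_zero_of_evalEval_eq_zero fun k h => ?_
      change ev k h (disc * Q) = 0
      obtain ⟨w, hw⟩ := hroot k h
      have h1 := hpt k h ((k + r * h - 1 + w) / 2) (by linear_combination hw / 4)
      have h2 := hpt k h ((k + r * h - 1 - w) / 2) (by linear_combination hw / 4)
      -- Subtracting the relations on the two sheets over `(k, h)` eliminates `P`.
      have h3 : w • ev k h Q = 0 := by
        have e : w • ev k h Q = (ev k h P + ((k + r * h - 1 + w) / 2) • ev k h Q)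
            - (ev k h P + ((k + r * h - 1 - w) / 2) • ev k h Q) := by module
        rw [e, h1, h2, sub_zero]
      rw [map_mul, hdisc, ← hw, ← Algebra.smul_def, sq, mul_smul, h3, smul_zero]
    refine (mul_eq_zero.1 hprod).resolve_left fun h0 => ?_
    have := hdisc 0 0
    rw [h0, map_zero] at this
    simp at this
  refine ⟨eq_zero_of_evalEval_eq_zero fun k h => ?_, hQ⟩
  obtain ⟨w, hw⟩ := hroot k h
  have h1 := hpt k h ((k + r * h - 1 + w) / 2) (by linear_combination hw / 4)
  rw [hQ, map_zero, smul_zero, add_zero] at h1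
  exact h1

theorem exists_eq_mul_X {A : Type*} [Semiring A] {p : A[X]} (h : p.coeff 0 = 0) :
    ∃ s, p = s * X :=
  ⟨p.divX, by simpa [h] using (divX_mul_X_add p).symm⟩

/-- A polynomial `p` with `a p(X + 1) = b p(X)` vanishes unless `a = b`. -/
theorem eq_zero_of_shift [Algebra ℂ R] [IsDomain R] {a b : R} (hab : a ≠ b) {p : R[X]}
    (h : ∀ t : ℂ, a * p.eval (algebraMap ℂ R (t + 1)) = b * p.eval (algebraMap ℂ R t)) :
    p = 0 := by
  have hp : C a * taylor 1 p - C b * p = 0 := by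
    refine eq_zero_of_infinite_isRoot _ (Set.infinite_of_injective_forall_mem
      (algebraMap ℂ R).injective fun t => ?_)
    have := h t
    rw [map_add, map_one, add_comm] at this
    change eval _ _ = 0
    rw [eval_sub, eval_mul, eval_mul, eval_C, eval_C, taylor_eval, add_comm, this, sub_self]
  -- The shift preserves the leading coefficient, so comparison in top degree leaves `a - b` times
  -- it.
  have hc := congrArg (fun r => coeff r p.natDegree) hp
  simp only [coeff_sub, coeff_C_mul, coeff_zero, coeff_taylor_natDegree, coeff_natDegree] at hc
  rw [← sub_mul] at hc
  exact leadingCoeff_eq_zero.1 ((mul_eq_zero.1 hc).resolve_left (sub_ne_zero.2 hab))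

end NormalForm

/-! ### Normalised coordinates on the spectral surface -/

theorem biform_linear_combination (B : Matrix (Fin 2) (Fin 2) ℂ) (p r : Fin 2 → ℂ)
    (a b c d : ℂ) :
    biform B (a • p + b • r) (c • p + d • r) = a * c * biform B p p + a * d * biform B p r
      + b * c * biform B r p + b * d * biform B r r := by
  simp only [biform, Pi.add_apply, Pi.smul_apply, smul_eq_mul]
  ring

theorem biform_add (B C : Matrix (Fin 2) (Fin 2) ℂ) (u v : Fin 2 → ℂ) :
    biform (B + C) u v = biform B u v + biform C u v := by
  simp only [biform, Matrix.add_apply]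
  ring

theorem biform_smul (a : ℂ) (B : Matrix (Fin 2) (Fin 2) ℂ) (u v : Fin 2 → ℂ) :
    biform (a • B) u v = a * biform B u v := by
  simp only [biform, Matrix.smul_apply, smul_eq_mul]
  ring

theorem eq_zero_of_biform_eq_zero {B : Matrix (Fin 2) (Fin 2) ℂ}
    (h : ∀ u v, biform B u v = 0) : B = 0 := by
  ext i j
  have := h (Pi.single i 1) (Pi.single j 1)
  fin_cases i <;> fin_cases j <;> simpa [biform] using this

/-- A singular `2 × 2` matrix is a column times a row. This is what lifts a point of the affine
quadric back to `ℂP¹ × ℂP¹`. -/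
theorem exists_rank_one_factorization {a b c d : ℂ} (h : a * d = b * c) :
    ∃ x₁ x₂ y₁ y₂ : ℂ, x₁ * y₁ = a ∧ x₁ * y₂ = b ∧ x₂ * y₁ = c ∧ x₂ * y₂ = d := by
  by_cases ha : a = 0
  · by_cases hb : b = 0
    · exact ⟨0, 1, c, d, by simp [ha], by simp [hb], by simp, by simp⟩
    · have hc : c = 0 := by
        have : b * c = 0 := by rw [← h, ha, zero_mul]
        exact (mul_eq_zero.1 this).resolve_left hb
      exact ⟨1, d / b, a, b, by simp, by simp, by simp [ha, hc], by field_simp⟩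
  · exact ⟨1, c / a, a, b, by simp, by simp, by field_simp, by field_simp; rw [h, mul_comm]⟩

namespace SpectralData

variable (X : SpectralData)

/-- The determinant of the two marked vectors. -/
def det : ℂ := X.p₁ 0 * X.p₂ 1 - X.p₁ 1 * X.p₂ 0

/-- The coordinate of a vector along `p₁`, rescaled by `A`. -/
def coord₁ (u : Fin 2 → ℂ) : ℂ := X.A * (u 0 * X.p₂ 1 - u 1 * X.p₂ 0) / X.det

/-- The coordinate of a vector along `p₂`. -/
def coord₂ (u : Fin 2 → ℂ) : ℂ := (X.p₁ 0 * u 1 - X.p₁ 1 * u 0) / X.det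

/-- The vector with given coordinates. -/
def vec (a b : ℂ) : Fin 2 → ℂ := (a / X.A) • X.p₁ + b • X.p₂

theorem det_ne_zero : X.det ≠ 0 := X.p_ne

theorem vec_coord (u : Fin 2 → ℂ) : X.vec (X.coord₁ u) (X.coord₂ u) = u := by
  have hd := X.det_ne_zero
  have hA := X.A_ne
  funext i
  simp only [vec, coord₁, coord₂, Pi.add_apply, Pi.smul_apply, smul_eq_mul]
  field_simp
  rw [det]
  fin_cases i <;> simp <;> ring

theorem coord₁_vec (a b : ℂ) : X.coord₁ (X.vec a b) = a := by
  have hd := X.det_ne_zero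
  have hA := X.A_ne
  simp only [vec, coord₁, Pi.add_apply, Pi.smul_apply, smul_eq_mul]
  field_simp
  rw [det]
  ring

theorem coord₂_vec (a b : ℂ) : X.coord₂ (X.vec a b) = b := by
  have hd := X.det_ne_zero
  have hA := X.A_ne
  simp only [vec, coord₂, Pi.add_apply, Pi.smul_apply, smul_eq_mul]
  field_simp
  rw [det]
  ring

theorem vec_one : X.vec X.A 0 = X.p₁ := by
  rw [vec, div_self X.A_ne, one_smul, zero_smul, add_zero]

theorem vec_two : X.vec 0 1 = X.p₂ := by
  rw [vec, zero_div, one_smul, zero_smul, zero_add]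

/-- The value of `f` at `(p₂, p₂)`. -/
def f₂₂ : ℂ := biform X.f X.p₂ X.p₂

theorem f_p₁_p₂ : biform X.f X.p₁ X.p₂ = X.A * X.f₂₂ := sub_eq_zero.1 (X.f_glue X.p₂)

theorem f_p₁_p₁ : biform X.f X.p₁ X.p₁ = X.A ^ 2 * X.f₂₂ := by
  rw [sub_eq_zero.1 (X.f_glue X.p₁), f_p₁_p₂]
  ring

/-- The remaining coefficient of the normalised form `f`. -/
def rho : ℂ := biform X.f X.p₂ X.p₁ / (X.A * X.f₂₂)

/-- By the gluing, the values of `f` at `(p₁, p₁)` and `(p₁, p₂)` are multiples of `f₂₂`; were it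
zero, `f` would vanish on the whole line `(p₁, t)`. -/
theorem f₂₂_ne_zero : X.f₂₂ ≠ 0 := by
  intro h
  obtain ⟨t, ht⟩ := X.f_line
  apply ht
  rw [← X.vec_coord t, ← X.vec_one]
  simp only [vec]
  rw [biform_linear_combination, f_p₁_p₁, f_p₁_p₂, h]
  simp

theorem biform_eq (B : Matrix (Fin 2) (Fin 2) ℂ) (u v : Fin 2 → ℂ) :
    biform B u v = X.coord₁ u * X.coord₁ v * (biform B X.p₁ X.p₁ / X.A ^ 2)
      + X.coord₁ u * X.coord₂ v * (biform B X.p₁ X.p₂ / X.A)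
      + X.coord₂ u * X.coord₁ v * (biform B X.p₂ X.p₁ / X.A)
      + X.coord₂ u * X.coord₂ v * biform B X.p₂ X.p₂ := by
  have hA := X.A_ne
  conv_lhs => rw [← X.vec_coord u, ← X.vec_coord v]
  simp only [vec]
  rw [biform_linear_combination]
  field_simp

theorem f_eq (u v : Fin 2 → ℂ) :
    biform X.f u v = X.f₂₂ * (X.coord₁ u * X.coord₁ v + X.coord₁ u * X.coord₂ v
      + X.rho * (X.coord₂ u * X.coord₁ v) + X.coord₂ u * X.coord₂ v) := by
  have hA := X.A_ne
  have hs := X.f₂₂_ne_zero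
  rw [X.biform_eq, f_p₁_p₁, f_p₁_p₂, rho, ← f₂₂]
  field_simp

/-- The function `s m₁₁ / f` on the surface. -/
def fnE (P : X.Pt) : ℂ :=
  X.f₂₂ * (X.coord₁ P.1.1 * X.coord₁ P.1.2) / biform X.f P.1.1 P.1.2

/-- The function `s m₂₁ / f` on the surface; it vanishes on the glued lines. -/
def fnH (P : X.Pt) : ℂ :=
  X.f₂₂ * (X.coord₂ P.1.1 * X.coord₁ P.1.2) / biform X.f P.1.1 P.1.2

/-- The function `s (2 m₁₁ + m₁₂) / f` on the surface; its increment is one. -/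
def fnK (P : X.Pt) : ℂ :=
  X.f₂₂ * (2 * (X.coord₁ P.1.1 * X.coord₁ P.1.2) + X.coord₁ P.1.1 * X.coord₂ P.1.2)
    / biform X.f P.1.1 P.1.2

theorem coord₁_mul_coord₁ (P : X.Pt) : X.coord₁ P.1.1 * X.coord₁ P.1.2
    = biform X.f P.1.1 P.1.2 / X.f₂₂ * X.fnE P := by
  have hP := P.2
  have hs := X.f₂₂_ne_zero
  rw [fnE]
  field_simp

theorem coord₂_mul_coord₁ (P : X.Pt) : X.coord₂ P.1.1 * X.coord₁ P.1.2
    = biform X.f P.1.1 P.1.2 / X.f₂₂ * X.fnH P := by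
  have hP := P.2
  have hs := X.f₂₂_ne_zero
  rw [fnH]
  field_simp

theorem coord₁_mul_coord₂ (P : X.Pt) : X.coord₁ P.1.1 * X.coord₂ P.1.2
    = biform X.f P.1.1 P.1.2 / X.f₂₂ * (X.fnK P - 2 * X.fnE P) := by
  have hP := P.2
  have hs := X.f₂₂_ne_zero
  rw [fnK, fnE]
  field_simp
  ring

theorem coord₂_mul_coord₂ (P : X.Pt) : X.coord₂ P.1.1 * X.coord₂ P.1.2
    = biform X.f P.1.1 P.1.2 / X.f₂₂ * (1 + X.fnE P - X.fnK P - X.rho * X.fnH P) := by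
  have hs := X.f₂₂_ne_zero
  have h : X.coord₂ P.1.1 * X.coord₂ P.1.2 = biform X.f P.1.1 P.1.2 / X.f₂₂
      - X.coord₁ P.1.1 * X.coord₁ P.1.2 - X.coord₁ P.1.1 * X.coord₂ P.1.2
      - X.rho * (X.coord₂ P.1.1 * X.coord₁ P.1.2) := by
    rw [X.f_eq P.1.1 P.1.2]
    field_simp
    ring
  rw [h, coord₁_mul_coord₁, coord₁_mul_coord₂, coord₂_mul_coord₁]
  ring

/-- The equation of the affine quadric. -/
theorem fn_relation (P : X.Pt) : X.fnE P * X.fnE P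
    = X.fnE P * (X.fnK P + (X.rho - 2) * X.fnH P - 1) + X.fnK P * X.fnH P := by
  have hP := P.2
  have hs := X.f₂₂_ne_zero
  have h : (X.coord₁ P.1.1 * X.coord₁ P.1.2) * (X.coord₂ P.1.1 * X.coord₂ P.1.2)
      = (X.coord₁ P.1.1 * X.coord₂ P.1.2) * (X.coord₂ P.1.1 * X.coord₁ P.1.2) := by ring
  rw [coord₁_mul_coord₁, coord₁_mul_coord₂, coord₂_mul_coord₁, coord₂_mul_coord₂] at h
  have h' : (biform X.f P.1.1 P.1.2 / X.f₂₂) ^ 2 * (X.fnE P *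
      (1 + X.fnE P - X.fnK P - X.rho * X.fnH P) - (X.fnK P - 2 * X.fnE P) * X.fnH P) = 0 := by
    linear_combination h
  have h'' := (mul_eq_zero.1 h').resolve_left (pow_ne_zero 2 (div_ne_zero hP hs))
  linear_combination h''

/-- Every point of the affine quadric comes from a point of the surface. -/
theorem exists_point {h k e : ℂ} (hr : e * e = e * (k + (X.rho - 2) * h - 1) + k * h) :
    ∃ P : X.Pt, X.fnH P = h ∧ X.fnK P = k ∧ X.fnE P = e := by
  have hs := X.f₂₂_ne_zero
  obtain ⟨x₁, x₂, y₁, y₂, h₁₁, h₁₂, h₂₁, h₂₂⟩ := exists_rank_one_factorization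
    (a := e) (b := k - 2 * e) (c := h) (d := 1 + e - k - X.rho * h) (by linear_combination hr)
  have hf : biform X.f (X.vec x₁ x₂) (X.vec y₁ y₂) = X.f₂₂ := by
    rw [f_eq]
    simp only [coord₁_vec, coord₂_vec, h₁₁, h₁₂, h₂₁, h₂₂]
    ring
  refine ⟨⟨(X.vec x₁ x₂, X.vec y₁ y₂), hf.symm ▸ hs⟩, ?_, ?_, ?_⟩
  · simp only [fnH, coord₁_vec, coord₂_vec, h₂₁, hf]
    field_simp
  · simp only [fnK, coord₁_vec, coord₂_vec, h₁₁, h₁₂, hf]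
    field_simp
    ring
  · simp only [fnE, coord₁_vec, h₁₁, hf]
    field_simp

/-! ### Restriction to the glued lines -/

theorem coord₁_p₁ : X.coord₁ X.p₁ = X.A := by
  conv_lhs => rw [← X.vec_one, coord₁_vec]

theorem coord₂_p₁ : X.coord₂ X.p₁ = 0 := by
  conv_lhs => rw [← X.vec_one, coord₂_vec]

theorem coord₁_p₂ : X.coord₁ X.p₂ = 0 := by
  conv_lhs => rw [← X.vec_two, coord₁_vec]

theorem coord₂_p₂ : X.coord₂ X.p₂ = 1 := by
  conv_lhs => rw [← X.vec_two, coord₂_vec]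

theorem f_p₁ (t : Fin 2 → ℂ) :
    biform X.f X.p₁ t = X.A * X.f₂₂ * (X.coord₁ t + X.coord₂ t) := by
  rw [f_eq, coord₁_p₁, coord₂_p₁]
  ring

theorem f_p₂ (t : Fin 2 → ℂ) : biform X.f t X.p₂ = X.f₂₂ * (X.coord₁ t + X.coord₂ t) := by
  rw [f_eq, coord₁_p₂, coord₂_p₂]
  ring

section Lines

variable (t : Fin 2 → ℂ) (h₁ : biform X.f X.p₁ t ≠ 0) (h₂ : biform X.f t X.p₂ ≠ 0)

theorem fnH_line₁ : X.fnH ⟨(X.p₁, t), h₁⟩ = 0 := by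
  simp [fnH, coord₂_p₁]

theorem fnH_line₂ : X.fnH ⟨(t, X.p₂), h₂⟩ = 0 := by
  simp [fnH, coord₁_p₂]

theorem fnE_line₂ : X.fnE ⟨(t, X.p₂), h₂⟩ = 0 := by
  simp [fnE, coord₁_p₂]

theorem fnE_line₁ : X.fnE ⟨(X.p₁, t), h₁⟩ = X.fnK ⟨(t, X.p₂), h₂⟩ := by
  have hA := X.A_ne
  have hs := X.f₂₂_ne_zero
  have h : X.coord₁ t + X.coord₂ t ≠ 0 := fun h => h₂ (by rw [f_p₂, h, mul_zero])
  simp only [fnE, fnK, coord₁_p₁, coord₁_p₂, coord₂_p₂, f_p₁, f_p₂]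
  field_simp
  ring

/-- With `σ = t₁ / (t₁ + t₂)`, where `t₁`, `t₂` are the coordinates of `t`, the two values are `(2
t₁ + t₂) / (t₁ + t₂) = σ + 1` and `σ`. The factor `2` in `fnK` is chosen for this. -/
theorem fnK_line₁ : X.fnK ⟨(X.p₁, t), h₁⟩ = X.fnK ⟨(t, X.p₂), h₂⟩ + 1 := by
  have hA := X.A_ne
  have hs := X.f₂₂_ne_zero
  have h : X.coord₁ t + X.coord₂ t ≠ 0 := fun h => h₂ (by rw [f_p₂, h, mul_zero])
  simp only [fnK, coord₁_p₁, coord₁_p₂, coord₂_p₂, f_p₁, f_p₂]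
  field_simp
  ring

end Lines

/-- The glued lines are parametrised by the value of `fnK` on the second one. -/
theorem exists_line_point (τ : ℂ) : ∃ t : Fin 2 → ℂ, biform X.f X.p₁ t ≠ 0 ∧
    ∃ h₂ : biform X.f t X.p₂ ≠ 0, X.fnK ⟨(t, X.p₂), h₂⟩ = τ := by
  have hs := X.f₂₂_ne_zero
  have e₁ : biform X.f X.p₁ (X.vec τ (1 - τ)) = X.A * X.f₂₂ := by
    rw [f_p₁, coord₁_vec, coord₂_vec]; ring
  have e₂ : biform X.f (X.vec τ (1 - τ)) X.p₂ = X.f₂₂ := by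
    rw [f_p₂, coord₁_vec, coord₂_vec]; ring
  refine ⟨X.vec τ (1 - τ), e₁ ▸ mul_ne_zero X.A_ne hs, e₂ ▸ hs, ?_⟩
  simp only [fnK, coord₁_p₂, coord₂_p₂, coord₁_vec, e₂]
  field_simp
  ring

/-! ### Forms whose quotient by `f` has a constant increment -/

/-- The constant coefficient of `B / f` in the basis `1, fnH, fnK`. -/
def coeffOne (B : Matrix (Fin 2) (Fin 2) ℂ) : ℂ := biform B X.p₂ X.p₂ / X.f₂₂

/-- The coefficient of `fnH` of `B / f` in the basis `1, fnH, fnK`. -/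
def coeffH (B : Matrix (Fin 2) (Fin 2) ℂ) : ℂ :=
  biform B X.p₂ X.p₁ / (X.A * X.f₂₂) - X.rho * X.coeffOne B

/-- The condition at `t = p₂` and then at `t = p₁` determines the values of `B` at `(p₁, p₂)` and
`(p₁, p₁)` from `B (p₂, p₂)` and `c`; the value at `(p₂, p₁)` stays free and gives the `fnH` term.
-/
theorem biform_eq_of_glue {B : Matrix (Fin 2) (Fin 2) ℂ} {c : ℂ}
    (hB : ∀ t, biform X.f X.p₁ t ≠ 0 →
      biform B X.p₁ t / biform X.f X.p₁ t - biform B t X.p₂ / biform X.f t X.p₂ - c = 0)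
    (u v : Fin 2 → ℂ) :
    biform B u v = X.coeffOne B * biform X.f u v
      + X.coeffH B * (X.f₂₂ * (X.coord₂ u * X.coord₁ v))
      + c * (X.f₂₂ * (2 * (X.coord₁ u * X.coord₁ v) + X.coord₁ u * X.coord₂ v)) := by
  have hA := X.A_ne
  have hs := X.f₂₂_ne_zero
  have e₂ : biform B X.p₁ X.p₂ = X.A * biform B X.p₂ X.p₂ + c * X.A * X.f₂₂ := by
    have := hB X.p₂ (by rw [f_p₁_p₂]; exact mul_ne_zero hA hs)
    rw [f_p₁_p₂, ← f₂₂] at this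
    field_simp at this
    linear_combination this
  have e₁ : biform B X.p₁ X.p₁ = X.A ^ 2 * biform B X.p₂ X.p₂ + 2 * c * X.A ^ 2 * X.f₂₂ := by
    have := hB X.p₁ (by rw [f_p₁_p₁]; exact mul_ne_zero (pow_ne_zero 2 hA) hs)
    rw [f_p₁_p₁, f_p₁_p₂, e₂] at this
    field_simp at this
    linear_combination this
  rw [X.biform_eq B, e₁, e₂, f_eq, coeffH, coeffOne]
  field_simp
  ring

theorem div_eq_of_glue {B : Matrix (Fin 2) (Fin 2) ℂ} {c : ℂ}
    (hB : ∀ t, biform X.f X.p₁ t ≠ 0 →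
      biform B X.p₁ t / biform X.f X.p₁ t - biform B t X.p₂ / biform X.f t X.p₂ - c = 0)
    (P : X.Pt) :
    biform B P.1.1 P.1.2 / biform X.f P.1.1 P.1.2
      = X.coeffOne B + X.coeffH B * X.fnH P + c * X.fnK P := by
  have hP := P.2
  rw [X.biform_eq_of_glue hB, fnH, fnK]
  field_simp

theorem F₁_eq (P : X.Pt) :
    X.F₁ P = X.coeffOne X.f₁ + X.coeffH X.f₁ * X.fnH P + X.c₁ * X.fnK P :=
  X.div_eq_of_glue X.f₁_glue P

theorem F₂_eq (P : X.Pt) :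
    X.F₂ P = X.coeffOne X.f₂ + X.coeffH X.f₂ * X.fnH P + X.c₂ * X.fnK P :=
  X.div_eq_of_glue X.f₂_glue P

/-- The Jacobian of the coordinates `F₁, F₂` with respect to `fnH, fnK`. -/
def jac : ℂ := X.coeffH X.f₁ * X.c₂ - X.coeffH X.f₂ * X.c₁

/-- A combination of `f₁`, `f₂` with no `fnH` and no `fnK` part is a multiple of `f`, so it is
trivial by independence. If the determinant vanished, its rows would supply such combinations,
forcing all its entries to be zero and then `f₁` itself to be a multiple of `f`. -/
theorem jac_ne_zero : X.jac ≠ 0 := by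
  intro hj
  have key : ∀ a b : ℂ, a * X.coeffH X.f₁ + b * X.coeffH X.f₂ = 0 → a * X.c₁ + b * X.c₂ = 0 →
      a = 0 ∧ b = 0 := by
    intro a b h1 h2
    have hz : a • X.f₁ + b • X.f₂
        + (-(a * X.coeffOne X.f₁ + b * X.coeffOne X.f₂)) • X.f = 0 := by
      refine eq_zero_of_biform_eq_zero fun u v => ?_
      rw [biform_add, biform_add, biform_smul, biform_smul, biform_smul,
        X.biform_eq_of_glue X.f₁_glue, X.biform_eq_of_glue X.f₂_glue]
      linear_combination (X.f₂₂ * (X.coord₂ u * X.coord₁ v)) * h1 +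
        (X.f₂₂ * (2 * (X.coord₁ u * X.coord₁ v) + X.coord₁ u * X.coord₂ v)) * h2
    have := Fintype.linearIndependent_iff.1 X.indep
      ![a, b, -(a * X.coeffOne X.f₁ + b * X.coeffOne X.f₂)]
      (by simpa [Fin.sum_univ_three] using hz)
    exact ⟨this 0, this 1⟩
  rw [jac] at hj
  obtain ⟨h1, h2⟩ := key X.c₂ (-X.c₁) (by linear_combination hj) (by ring)
  obtain ⟨h3, h4⟩ := key (X.coeffH X.f₂) (-X.coeffH X.f₁) (by ring) (by linear_combination -hj)
  rw [neg_eq_zero] at h2 h4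
  exact one_ne_zero (key 1 0 (by rw [h4, h3]; ring) (by rw [h1, h2]; ring)).1

end SpectralData

/-! ### Generators of the ring of differential operators -/

section Operators

variable (q : ℂ × ℂ)

/-- Multiplication by a germ, as a differential operator. -/
def mulOp : Oan q →+* Dops q where
  toFun g := ⟨LinearMap.mulLeft ℂ g, Algebra.subset_adjoin (Or.inl ⟨g, rfl⟩)⟩
  map_one' := Subtype.ext (LinearMap.mulLeft_one ℂ _)
  map_zero' := Subtype.ext (LinearMap.mulLeft_zero_eq_zero ℂ _)
  map_mul' a b := Subtype.ext (LinearMap.mulLeft_mul ℂ _ a b)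
  map_add' a b := Subtype.ext (LinearMap.ext fun c => add_mul a b c)

variable {q}

theorem mulOp_smul_germ (g h : Oan q) : mulOp q g • h = g * h := rfl

theorem mulOp_injective : Function.Injective (mulOp q) := by
  intro a b h
  have := congrArg (fun d : Dops q => d • (1 : Oan q)) h
  simpa [mulOp_smul_germ] using this

theorem algebraMap_dops (r : ℂ) :
    algebraMap ℂ (Dops q) r = mulOp q (algebraMap ℂ (Oan q) r) := by
  refine Subtype.ext (LinearMap.ext fun c => ?_)
  change r • c = algebraMap ℂ (Oan q) r * c
  rw [Algebra.smul_def]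

variable (q) in
instance dopsRing : Ring (Dops q) := Algebra.semiringToRing ℂ

theorem dops_ext {d e : Dops q} (h : ∀ g : Oan q, d • g = e • g) : d = e :=
  Subtype.ext (LinearMap.ext h)

variable (q) in
theorem partialD_mem (v : ℂ × ℂ) : (partialD q v : Oan q →ₗ[ℂ] Oan q) ∈ diffOps q := by
  have h : (partialD q v : Oan q →ₗ[ℂ] Oan q) = v.1 • (partialD q (1, 0) : Oan q →ₗ[ℂ] Oan q)
      + v.2 • (partialD q (0, 1) : Oan q →ₗ[ℂ] Oan q) := LinearMap.ext fun g => partialD_eq v g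
  have hx : (partialD q (1, 0) : Oan q →ₗ[ℂ] Oan q) ∈ diffOps q :=
    Algebra.subset_adjoin (Or.inr (Or.inl rfl))
  have hy : (partialD q (0, 1) : Oan q →ₗ[ℂ] Oan q) ∈ diffOps q :=
    Algebra.subset_adjoin (Or.inr (Or.inr rfl))
  rw [h]
  exact add_mem ((diffOps q).smul_mem hx _) ((diffOps q).smul_mem hy _)

variable (q) in
/-- Differentiation in the direction `v`, as a differential operator. -/
def dirOp (v : ℂ × ℂ) : Dops q := ⟨(partialD q v : Oan q →ₗ[ℂ] Oan q), partialD_mem q v⟩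

theorem dirOp_smul_germ (v : ℂ × ℂ) (h : Oan q) : dirOp q v • h = partialD q v h := rfl

theorem dirOp_mul_mulOp (v : ℂ × ℂ) (g : Oan q) :
    dirOp q v * mulOp q g = mulOp q g * dirOp q v + mulOp q (partialD q v g) := by
  refine dops_ext fun h => ?_
  rw [add_smul, mul_smul, mul_smul, mulOp_smul_germ, mulOp_smul_germ, mulOp_smul_germ,
    dirOp_smul_germ, dirOp_smul_germ, Derivation.leibniz]
  simp only [smul_eq_mul]
  ring

theorem dirOp_commute (v w : ℂ × ℂ) : Commute (dirOp q v) (dirOp q w) :=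
  dops_ext fun h => partialD_comm v w h

theorem dirOp_linear (a b : ℂ) (v w : ℂ × ℂ) :
    dirOp q (a • v + b • w) = algebraMap ℂ (Dops q) a * dirOp q v
      + algebraMap ℂ (Dops q) b * dirOp q w := by
  refine dops_ext fun h => ?_
  rw [← Algebra.smul_def, ← Algebra.smul_def]
  change partialD q (a • v + b • w) h = a • partialD q v h + b • partialD q w h
  rw [partialD_eq, partialD_eq v, partialD_eq w]
  simp only [Prod.fst_add, Prod.snd_add, Prod.smul_fst, Prod.smul_snd, smul_eq_mul]
  module

theorem dops_induction {p : Dops q → Prop} (hmul : ∀ g, p (mulOp q g))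
    (hx : p (dirOp q (1, 0))) (hy : p (dirOp q (0, 1)))
    (hadd : ∀ d e, p d → p e → p (d + e)) (hcomp : ∀ d e, p d → p e → p (d * e))
    (d : Dops q) : p d := by
  obtain ⟨d, hd⟩ := d
  induction hd using Algebra.adjoin_induction with
  | mem d hd =>
    rcases hd with ⟨g, rfl⟩ | rfl | rfl
    · exact hmul g
    · exact hx
    · exact hy
  | algebraMap r =>
    have h := hmul (algebraMap ℂ (Oan q) r)
    rw [← algebraMap_dops] at h
    exact h
  | add d e _ _ ih ih' => exact hadd _ _ ih ih'
  | mul d e _ _ ih ih' => exact hcomp _ _ ih ih'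

/-- The Ore condition: a germ can be moved from the left to the right of an operator, at the cost
of a power. -/
theorem exists_pow_mul_eq_mul (d : Dops q) :
    ∀ g : Oan q, ∃ (N : ℕ) (d' : Dops q), mulOp q (g ^ N) * d = d' * mulOp q g := by
  have dir (v : ℂ × ℂ) : ∀ g : Oan q, ∃ (N : ℕ) (d' : Dops q),
      mulOp q (g ^ N) * dirOp q v = d' * mulOp q g := by
    intro g
    -- The identity `g² ∂ = (g ∂ - ∂(g)) g`.
    refine ⟨2, mulOp q g * dirOp q v - mulOp q (partialD q v g), ?_⟩
    rw [sub_mul, mul_assoc, dirOp_mul_mulOp, mul_add, ← map_mul, ← map_mul,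
      mul_comm (partialD q v g), add_sub_cancel_right, ← mul_assoc, ← map_mul, sq]
  induction d using dops_induction with
  | hmul h =>
    intro g
    exact ⟨1, mulOp q h, by rw [pow_one, ← map_mul, ← map_mul, mul_comm]⟩
  | hx => exact dir _
  | hy => exact dir _
  | hadd d e hd he =>
    intro g
    obtain ⟨M, d', hd⟩ := hd g
    obtain ⟨N, e', he⟩ := he g
    refine ⟨M + N, mulOp q (g ^ N) * d' + mulOp q (g ^ M) * e', ?_⟩
    rw [add_mul, mul_assoc, mul_assoc, ← hd, ← he, ← mul_assoc, ← mul_assoc, ← map_mul, ← map_mul,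
      mul_add, pow_add, mul_comm (g ^ N)]
  | hcomp d e hd he =>
    intro g
    obtain ⟨N, e', he⟩ := he g
    obtain ⟨M, d', hd⟩ := hd (g ^ N)
    -- Moving `g` past `e` costs `g ^ N`, so it is `g ^ N`, not `g`, that has to be moved past `d`.
    refine ⟨N * M, d' * e', ?_⟩
    rw [pow_mul, ← mul_assoc, hd, mul_assoc, he, mul_assoc]

end Operators

namespace SpectralData

open Polynomial

variable (X : SpectralData) (q : ℂ × ℂ)

/-! ### Operators adapted to the functions `fnH` and `fnK` -/

/-- The operator acting on the exponential as multiplication by `fnH`. -/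
def opH : Dops q := dirOp q (X.c₂ / X.jac, -X.c₁ / X.jac)
  + algebraMap ℂ (Dops q) (-(X.c₂ * X.coeffOne X.f₁ - X.c₁ * X.coeffOne X.f₂) / X.jac)

/-- The operator acting on the exponential as multiplication by `fnK`. -/
def opK : Dops q := dirOp q (-X.coeffH X.f₂ / X.jac, X.coeffH X.f₁ / X.jac)
  + algebraMap ℂ (Dops q)
    (-(X.coeffH X.f₁ * X.coeffOne X.f₂ - X.coeffH X.f₂ * X.coeffOne X.f₁) / X.jac)

variable {q}

theorem opH_mul_mulOp (g : Oan q) : X.opH q * mulOp q g = mulOp q g * X.opH q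
    + mulOp q (partialD q (X.c₂ / X.jac, -X.c₁ / X.jac) g) := by
  rw [opH, add_mul, dirOp_mul_mulOp, mul_add, Algebra.commutes, add_right_comm]

theorem opK_mul_mulOp (g : Oan q) : X.opK q * mulOp q g = mulOp q g * X.opK q
    + mulOp q (partialD q (-X.coeffH X.f₂ / X.jac, X.coeffH X.f₁ / X.jac) g) := by
  rw [opK, add_mul, dirOp_mul_mulOp, mul_add, Algebra.commutes, add_right_comm]

theorem opH_commute_opK : Commute (X.opH q) (X.opK q) :=
  ((dirOp_commute _ _).add_right (Algebra.commute_algebraMap_right _ _)).add_left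
    (Algebra.commute_algebraMap_left _ _)

/-- This inverts the change from `∂ₓ`, `∂_y` to `opH`, `opK`; its determinant is controlled by
`jac`. -/
theorem dirOp_eq (a b : ℂ) : dirOp q (a, b) =
    algebraMap ℂ (Dops q) (a * X.coeffH X.f₁ + b * X.coeffH X.f₂) * X.opH q
    + algebraMap ℂ (Dops q) (a * X.c₁ + b * X.c₂) * X.opK q
    + algebraMap ℂ (Dops q) (a * X.coeffOne X.f₁ + b * X.coeffOne X.f₂) := by
  have hj := X.jac_ne_zero
  have hv : (a, b) = (a * X.coeffH X.f₁ + b * X.coeffH X.f₂) • (X.c₂ / X.jac, -X.c₁ / X.jac)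
      + (a * X.c₁ + b * X.c₂) • (-X.coeffH X.f₂ / X.jac, X.coeffH X.f₁ / X.jac) := by
    refine Prod.ext ?_ ?_
    · simp only [Prod.smul_mk, Prod.mk_add_mk, smul_eq_mul]
      field_simp
      rw [jac]
      ring
    · simp only [Prod.smul_mk, Prod.mk_add_mk, smul_eq_mul]
      field_simp
      rw [jac]
      ring
  rw [hv, dirOp_linear, opH, opK, mul_add, mul_add, ← map_mul, ← map_mul, add_add_add_comm,
    add_assoc, ← map_add, ← map_add]
  have hc : (a * X.coeffH X.f₁ + b * X.coeffH X.f₂) *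
        (-(X.c₂ * X.coeffOne X.f₁ - X.c₁ * X.coeffOne X.f₂) / X.jac)
      + (a * X.c₁ + b * X.c₂) *
        (-(X.coeffH X.f₁ * X.coeffOne X.f₂ - X.coeffH X.f₂ * X.coeffOne X.f₁) / X.jac)
      + (a * X.coeffOne X.f₁ + b * X.coeffOne X.f₂) = 0 := by
    field_simp
    rw [jac]
    ring
  rw [hc, map_zero, add_zero]

variable (q) in
/-- The normal form of differential operators in terms of `opH` and `opK`. -/
def normalForm : (Oan q)[X][X] →+ Dops q := opOfPoly (mulOp q) (X.opH q) (X.opK q)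

/-- The set of normal forms contains `1` and is stable under left multiplication by germs and, via
`dirOp_eq`, by `∂ₓ` and `∂_y`. -/
theorem normalForm_surjective : Function.Surjective (X.normalForm q) := by
  have dir (a b : ℂ) (P) :
      dirOp q (a, b) * X.normalForm q P ∈ AddMonoidHom.mrange (X.normalForm q) := by
    have hm (r : ℂ) {e : Dops q} (he : e ∈ AddMonoidHom.mrange (X.normalForm q)) :
        algebraMap ℂ (Dops q) r * e ∈ AddMonoidHom.mrange (X.normalForm q) := by
      obtain ⟨P, rfl⟩ := he
      rw [algebraMap_dops]
      exact coeff_mul_opOfPoly_mem _ _ _ _ _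
    rw [X.dirOp_eq a b, add_mul, add_mul, mul_assoc, mul_assoc]
    exact add_mem (add_mem (hm _ (fst_mul_opOfPoly_mem X.opH_commute_opK X.opH_mul_mulOp P))
      (hm _ (snd_mul_opOfPoly_mem X.opK_mul_mulOp P))) (hm _ ⟨P, rfl⟩)
  have key (d : Dops q) : ∀ P, d * X.normalForm q P ∈ AddMonoidHom.mrange (X.normalForm q) := by
    induction d using dops_induction with
    | hmul g => exact coeff_mul_opOfPoly_mem _ _ _ g
    | hx => exact dir 1 0
    | hy => exact dir 0 1
    | hadd d e hd he => intro P; rw [add_mul]; exact add_mem (hd P) (he P)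
    | hcomp d e hd he =>
      intro P
      obtain ⟨Q, hQ⟩ := he P
      rw [mul_assoc, ← hQ]
      exact hd Q
  intro d
  obtain ⟨P, hP⟩ := key d 1
  exact ⟨P, by rw [hP, normalForm, opOfPoly_one, mul_one]⟩

theorem normalForm_mul_X (P : (Oan q)[X][X]) :
    X.normalForm q (P * Polynomial.X) = X.normalForm q P * X.opH q := by
  induction P using opOfPoly_induction with
  | hadd P Q hP hQ => rw [add_mul, map_add, map_add, hP, hQ, add_mul]
  | hmon i j a =>
    rw [monomial_mul_X, normalForm, opOfPoly_monomial_monomial, opOfPoly_monomial_monomial,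
      pow_succ, mul_assoc _ _ (X.opH q)]

/-- Nonzero germs can be cancelled on the right of an operator. -/
theorem eq_zero_of_mul_mulOp (X : SpectralData) {d : Dops q} {g : Oan q} (hg : g ≠ 0) (h : d * mulOp q g = 0) :
    d = 0 := by
  have hj := X.jac_ne_zero
  have : CharZero (Oan q) := charZero_of_injective_algebraMap (algebraMap ℂ (Oan q)).injective
  obtain ⟨P, rfl⟩ := X.normalForm_surjective d
  have hP : P = 0 := by
    -- These linear functions of `(x, y)`, the coefficients of `fnH` and `fnK` in the exponent `x F₁
    -- + y F₂`, are dual to `opH` and `opK`.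
    refine opOfPoly_mul_eq_zero mulOp_injective
      (x := linGerm q (X.coeffH X.f₁) (X.coeffH X.f₂)) (y := linGerm q X.c₁ X.c₂)
      ?_ ?_ ?_ hg h
    · rw [opH_mul_mulOp, partialD_linGerm, ← map_one (mulOp q), ← map_one (algebraMap ℂ (Oan q))]
      congr 3
      field_simp
      rw [jac]
      ring
    · rw [Commute, SemiconjBy, opK_mul_mulOp, partialD_linGerm]
      have e : -X.coeffH X.f₂ / X.jac * X.coeffH X.f₁ + X.coeffH X.f₁ / X.jac * X.coeffH X.f₂
          = 0 := by ring
      rw [e, map_zero, map_zero, add_zero]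
    · rw [opK_mul_mulOp, partialD_linGerm, ← map_one (mulOp q), ← map_one (algebraMap ℂ (Oan q))]
      congr 3
      field_simp
      rw [jac]
      ring
  rw [hP, map_zero]

/-! ### The exponential and the functions it generates -/

variable (q) in
/-- The function `exp (x F₁ + y F₂)`. -/
def expFn : X.Pt → Oan q := fun P => expGerm q (X.F₁ P) (X.F₂ P)

variable (q) in
/-- Multiplication by a function on the surface that does not depend on `(x, y)`. -/
def scale (ζ : X.Pt → ℂ) : (X.Pt → Oan q) →ₗ[Dops q] (X.Pt → Oan q) where
  toFun z P := ζ P • z P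
  map_add' _ _ := funext fun _ => smul_add _ _ _
  map_smul' d z := funext fun P =>
    ((d : Module.End ℂ (Oan q)).map_smul (ζ P) (z P)).symm

theorem scale_apply (ζ : X.Pt → ℂ) (z : X.Pt → Oan q) (P : X.Pt) :
    X.scale q ζ z P = ζ P • z P := rfl

theorem mulOp_smul_apply (g : Oan q) (z : X.Pt → Oan q) (P : X.Pt) :
    (mulOp q g • z) P = g * z P := rfl

theorem algebraMap_smul_apply (r : ℂ) (z : X.Pt → Oan q) (P : X.Pt) :
    (algebraMap ℂ (Dops q) r • z) P = r • z P := rfl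

theorem dirOp_smul_expFn (v : ℂ × ℂ) (P : X.Pt) :
    (dirOp q v • X.expFn q) P = (v.1 * X.F₁ P + v.2 * X.F₂ P) • X.expFn q P :=
  partialD_expGerm q v _ _

theorem opH_smul_expFn : X.opH q • X.expFn q = X.scale q X.fnH (X.expFn q) := by
  have hj := X.jac_ne_zero
  funext P
  rw [opH, add_smul, Pi.add_apply, dirOp_smul_expFn, algebraMap_smul_apply, ← add_smul,
    scale_apply, F₁_eq, F₂_eq]
  congr 1
  field_simp
  rw [jac]
  ring

theorem opK_smul_expFn : X.opK q • X.expFn q = X.scale q X.fnK (X.expFn q) := by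
  have hj := X.jac_ne_zero
  funext P
  rw [opK, add_smul, Pi.add_apply, dirOp_smul_expFn, algebraMap_smul_apply, ← add_smul,
    scale_apply, F₁_eq, F₂_eq]
  congr 1
  field_simp
  rw [jac]
  ring

theorem pow_smul_eq_scale {d : Dops q} {ζ : X.Pt → ℂ} (h : d • X.expFn q = X.scale q ζ (X.expFn q))
    (n : ℕ) : d ^ n • X.expFn q = X.scale q (ζ ^ n) (X.expFn q) := by
  induction n with
  | zero => funext P; simp [scale_apply]
  | succ n ih =>
    rw [pow_succ', mul_smul, ih, ← map_smul, h]
    funext P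
    simp only [scale_apply, smul_smul, pow_succ, Pi.mul_apply]

/-- The exponential is a joint eigenfunction of `opH` and `opK`, so an operator in normal form acts
on it as its symbol. -/
theorem normalForm_smul_expFn (R : (Oan q)[X][X]) (P : X.Pt) :
    (X.normalForm q R • X.expFn q) P
      = R.evalEval (algebraMap ℂ (Oan q) (X.fnK P)) (algebraMap ℂ (Oan q) (X.fnH P))
        * X.expFn q P := by
  induction R using opOfPoly_induction with
  | hadd R S hR hS => rw [map_add, add_smul, Pi.add_apply, hR, hS, evalEval_add, add_mul]
  | hmon i j a =>
    rw [normalForm, opOfPoly_monomial_monomial, mul_smul, mul_smul,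
      X.pow_smul_eq_scale X.opH_smul_expFn, ← map_smul, X.pow_smul_eq_scale X.opK_smul_expFn,
      mulOp_smul_apply, scale_apply, scale_apply]
    simp only [evalEval, eval_monomial, eval_mul, eval_pow, eval_C, Pi.pow_apply]
    simp only [Algebra.smul_def, map_pow]
    ring

theorem isUnit_expFn (P : X.Pt) : IsUnit (X.expFn q P) :=
  IsUnit.of_mul_eq_one_right _ (expGerm_neg_mul _ _)

/-- The functions `1` and `fnE` are independent over the operators acting on the exponential. -/
theorem eq_zero_of_smul_expFn {R S : (Oan q)[X][X]}
    (h : X.normalForm q R • X.expFn q + X.scale q X.fnE (X.normalForm q S • X.expFn q) = 0) :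
    R = 0 ∧ S = 0 := by
  refine eq_zero_of_double_cover (X.rho - 2) fun k h' e hr => ?_
  obtain ⟨P, rfl, rfl, rfl⟩ := X.exists_point hr
  have := congrFun h P
  rw [Pi.add_apply, scale_apply, normalForm_smul_expFn, normalForm_smul_expFn, ← smul_mul_assoc,
    ← add_mul] at this
  exact (mul_eq_zero.1 this).resolve_right (X.isUnit_expFn P).ne_zero

theorem eq_zero_of_smul_expFn_add {a b : Dops q}
    (h : a • X.expFn q + X.scale q X.fnE (b • X.expFn q) = 0) : a = 0 ∧ b = 0 := by
  obtain ⟨R, rfl⟩ := X.normalForm_surjective a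
  obtain ⟨S, rfl⟩ := X.normalForm_surjective b
  obtain ⟨rfl, rfl⟩ := X.eq_zero_of_smul_expFn h
  simp

/-- On symbols, right multiplication by `opH` is multiplication by the outer variable, and symbols
are determined by their action on the exponential. -/
theorem eq_zero_of_mul_opH {d : Dops q} (h : d * X.opH q = 0) : d = 0 := by
  obtain ⟨R, rfl⟩ := X.normalForm_surjective d
  have h0 : R * Polynomial.X = 0 := (X.eq_zero_of_smul_expFn (S := 0)
    (by rw [normalForm_mul_X, h]; simp)).1
  rw [(mul_eq_zero.1 h0).resolve_right X_ne_zero, map_zero]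

variable (q)

/-! ### Generators of the Baker–Akhiezer module -/

/-- The ratio `Λ exp (-c₁ x - c₂ y)` of the multipliers. -/
def mu : Oan q := X.Λ • expGerm q (-X.c₁) (-X.c₂)

/-- The germ `1 - Λ exp (-c₁ x - c₂ y)`. -/
def gap : Oan q := 1 - X.mu q

/-- The generator of `M(1)` that does not vanish on the glued lines. -/
def genG : X.Pt → Oan q := (1 + mulOp q (-X.gap q) * X.opK q) • X.expFn q
  + X.scale q X.fnE (mulOp q (X.gap q ^ 2) • X.expFn q)

/-- The generator of `M(1)` that vanishes on the glued lines. -/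
def genH : X.Pt → Oan q := X.opH q • X.expFn q

variable {q}

theorem genG_apply (P : X.Pt) : X.genG q P
    = (1 - X.fnK P • X.gap q + X.fnE P • X.gap q ^ 2) * X.expFn q P := by
  rw [genG, Pi.add_apply, add_smul, Pi.add_apply, mul_smul, opK_smul_expFn, one_smul,
    mulOp_smul_apply, scale_apply, scale_apply, mulOp_smul_apply]
  simp only [Algebra.smul_def]
  ring

theorem genH_apply (P : X.Pt) : X.genH q P = X.fnH P • X.expFn q P := by
  rw [genH, opH_smul_expFn, scale_apply]

theorem valueHom_gap :
    valueHom q (X.gap q) = 1 - X.Λ * Complex.exp (-(q.1 * X.c₁ + q.2 * X.c₂)) := by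
  rw [gap, map_sub, map_one, mu, valueHom_smul, valueHom_expGerm]
  congr 3
  ring

theorem smul_eq_mu_mul (z : Oan q) : X.Λ • z = X.mu q * (expGerm q X.c₁ X.c₂ * z) := by
  rw [mu, smul_mul_assoc, ← mul_assoc, expGerm_neg_mul, one_mul]

/-- If it vanished, `Λ exp (-c₁ x - c₂ y)` would be the constant `1`; differentiating gives `c₁ = c₂
= 0`, contrary to `jac_ne_zero`. -/
theorem gap_ne_zero : X.gap q ≠ 0 := by
  intro h
  have hmu : X.mu q = 1 := (sub_eq_zero.1 h).symm
  have key (v : ℂ × ℂ) : v.1 * X.c₁ + v.2 * X.c₂ = 0 := by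
    have h1 : partialD q v (X.mu q) = (v.1 * -X.c₁ + v.2 * -X.c₂) • X.mu q := by
      rw [mu, Derivation.map_smul, partialD_expGerm, smul_comm]
    rw [hmu, Derivation.map_one_eq_zero] at h1
    have := (smul_eq_zero.1 h1.symm).resolve_right one_ne_zero
    linear_combination -this
  have h1 := key (1, 0)
  have h2 := key (0, 1)
  simp only [one_mul, zero_mul, add_zero, zero_add] at h1 h2
  exact X.jac_ne_zero (by rw [jac, h1, h2]; ring)

section Lines

variable (t : Fin 2 → ℂ) (h₁ : biform X.f X.p₁ t ≠ 0) (h₂ : biform X.f t X.p₂ ≠ 0)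

/-- Since `fnH` is zero on both lines and `fnK` jumps by one, `F₁` and `F₂` jump by `c₁` and `c₂`.
-/
theorem expFn_line₁ : X.expFn q ⟨(X.p₁, t), h₁⟩
    = expGerm q X.c₁ X.c₂ * X.expFn q ⟨(t, X.p₂), h₂⟩ := by
  rw [expFn, expFn, expGerm_mul]
  simp only [F₁_eq, F₂_eq, fnH_line₁, fnH_line₂, X.fnK_line₁ t h₁ h₂]
  congr 1 <;> ring

end Lines

theorem glued_genG : X.Glued (X.genG q) := by
  intro t h₁ h₂
  rw [genG_apply, genG_apply, smul_eq_mu_mul, X.expFn_line₁ t h₁ h₂, X.fnK_line₁ t h₁ h₂,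
    X.fnE_line₁ t h₁ h₂, fnE_line₂, gap]
  simp only [Algebra.smul_def, map_add, map_one, map_zero]
  ring

theorem glued_genH : X.Glued (X.genH q) := by
  intro t h₁ h₂
  rw [genH_apply, genH_apply, fnH_line₁, fnH_line₂]
  simp

/-! ### Forms of bidegree `(1, 1)` -/

theorem exists_form_biform (B : Matrix (Fin 2) (Fin 2) ℂ) (a : Oan q) :
    ∃ c : ℕ → ℕ → Oan q, ∀ u v, form 1 c u v = biform B u v • a := by
  obtain ⟨c, hc⟩ := form_biform 0 B (fun _ _ => a)
  exact ⟨c, fun u v => by rw [hc]; simp [form]⟩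

/-- The coefficients of the linear form `coord₁`. -/
def coordVec₁ : Fin 2 → ℂ := ![X.A * X.p₂ 1 / X.det, -(X.A * X.p₂ 0) / X.det]

/-- The coefficients of the linear form `coord₂`. -/
def coordVec₂ : Fin 2 → ℂ := ![-X.p₁ 1 / X.det, X.p₁ 0 / X.det]

theorem biform_vecMulVec (l m u v : Fin 2 → ℂ) :
    biform (Matrix.vecMulVec l m) u v = (l 0 * u 0 + l 1 * u 1) * (m 0 * v 0 + m 1 * v 1) := by
  simp only [biform, Matrix.vecMulVec_apply]
  ring

theorem coord₁_eq (u : Fin 2 → ℂ) :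
    X.coordVec₁ 0 * u 0 + X.coordVec₁ 1 * u 1 = X.coord₁ u := by
  simp only [coordVec₁, coord₁, Matrix.cons_val_zero, Matrix.cons_val_one]
  ring

theorem coord₂_eq (u : Fin 2 → ℂ) :
    X.coordVec₂ 0 * u 0 + X.coordVec₂ 1 * u 1 = X.coord₂ u := by
  simp only [coordVec₂, coord₂, Matrix.cons_val_zero, Matrix.cons_val_one]
  ring

theorem hasForm_one {z : X.Pt → Oan q} (a b c d : Oan q) (hz : ∀ P, z P
    = (a + X.fnH P • b + X.fnK P • c + X.fnE P • d) * X.expFn q P) : X.HasForm 1 z := by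
  obtain ⟨ca, ha⟩ := exists_form_biform X.f a
  obtain ⟨cb, hb⟩ := exists_form_biform (Matrix.vecMulVec X.coordVec₂ X.coordVec₁) (X.f₂₂ • b)
  obtain ⟨cc, hc⟩ := exists_form_biform (Matrix.vecMulVec X.coordVec₁ X.coordVec₂) (X.f₂₂ • c)
  -- The extra `2 • c` comes from the doubled term in the numerator of `fnK`.
  obtain ⟨cd, hd⟩ := exists_form_biform (Matrix.vecMulVec X.coordVec₁ X.coordVec₁)
    (X.f₂₂ • (2 • c + d))
  refine ⟨ca + cb + cc + cd, fun P => ?_⟩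
  rw [hz, form_add, form_add, form_add, ha, hb, hc, hd, biform_vecMulVec, biform_vecMulVec,
    biform_vecMulVec, coord₁_eq, coord₁_eq, coord₂_eq, coord₂_eq, pow_one]
  have hP := P.2
  have hs := X.f₂₂_ne_zero
  change _ = _ * X.expFn q P
  congr 1
  rw [coord₁_mul_coord₁, coord₁_mul_coord₂, coord₂_mul_coord₁]
  simp only [smul_add, smul_smul, nsmul_eq_mul, Nat.cast_ofNat]
  have e1 : 1 / biform X.f P.1.1 P.1.2 * biform X.f P.1.1 P.1.2 = 1 := by field_simp
  have e2 (x : ℂ) : 1 / biform X.f P.1.1 P.1.2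
      * (biform X.f P.1.1 P.1.2 / X.f₂₂ * x * X.f₂₂) = x := by field_simp
  simp only [e1, e2, one_smul, two_mul, smul_add]
  module

theorem genG_mem_level : X.genG q ∈ X.level q 1 :=
  ⟨X.hasForm_one 1 0 (-X.gap q) (X.gap q ^ 2) fun P => by
    rw [genG_apply, smul_zero, smul_neg, add_zero, ← sub_eq_add_neg], X.glued_genG⟩

theorem genH_mem_level : X.genH q ∈ X.level q 1 :=
  ⟨X.hasForm_one 0 1 0 0 fun P => by simp [genH_apply], X.glued_genH⟩

/-- A form of bidegree `(1, 1)` is determined by its values at the four pairs made of `p₁` and `p₂`,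
and the four coordinate products are `f` times combinations of `1`, `fnH`, `fnK`, `fnE`. -/
theorem exists_of_hasForm_one {z : X.Pt → Oan q} (hz : X.HasForm 1 z) : ∃ a b c d : Oan q,
    ∀ P, z P = (a + X.fnH P • b + X.fnK P • c + X.fnE P • d) * X.expFn q P := by
  obtain ⟨c, hc⟩ := hz
  have hA := X.A_ne
  have hs := X.f₂₂_ne_zero
  have hform (a b a' b' : ℂ) : form 1 c (X.vec a b) (X.vec a' b') =
      (a * a') • ((1 / X.A ^ 2) • form 1 c X.p₁ X.p₁) + (a * b') • ((1 / X.A) • form 1 c X.p₁ X.p₂)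
      + (b * a') • ((1 / X.A) • form 1 c X.p₂ X.p₁) + (b * b') • form 1 c X.p₂ X.p₂ := by
    simp only [form, vec, Finset.sum_range_succ, Finset.sum_range_zero, zero_add, pow_zero, pow_one,
      Nat.sub_zero, Nat.sub_self, one_mul, mul_one, Pi.add_apply, Pi.smul_apply, smul_eq_mul]
    match_scalars <;> field_simp <;> ring
  refine ⟨(1 / X.f₂₂) • form 1 c X.p₂ X.p₂, (1 / X.f₂₂) • ((1 / X.A) • form 1 c X.p₂ X.p₁)
    - (X.rho / X.f₂₂) • form 1 c X.p₂ X.p₂, (1 / X.f₂₂) • ((1 / X.A) • form 1 c X.p₁ X.p₂)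
    - (1 / X.f₂₂) • form 1 c X.p₂ X.p₂, (1 / X.f₂₂) • ((1 / X.A ^ 2) • form 1 c X.p₁ X.p₁)
    - (2 / X.f₂₂) • ((1 / X.A) • form 1 c X.p₁ X.p₂) + (1 / X.f₂₂) • form 1 c X.p₂ X.p₂,
    fun P => ?_⟩
  have hP := P.2
  rw [hc, pow_one]
  change _ * X.expFn q P = _
  congr 1
  conv_lhs => rw [← X.vec_coord P.1.1, ← X.vec_coord P.1.2]
  rw [hform]
  rw [vec_coord, vec_coord, coord₁_mul_coord₁, coord₁_mul_coord₂, coord₂_mul_coord₁,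
    coord₂_mul_coord₂]
  match_scalars <;> field_simp <;> ring

/-- On the glued lines the condition is affine in the parameter `τ`, so it amounts to two linear
equations, which express the `fnK` and `fnE` coefficients through the constant one. The `fnH`
coefficient is unconstrained. -/
theorem exists_of_mem_level_one {ψ : X.Pt → Oan q} (hψ : ψ ∈ X.level q 1) :
    ∃ a b : Oan q, ψ = a • X.genG q + b • X.genH q := by
  obtain ⟨hform, hglue⟩ := hψ
  obtain ⟨a, b, c, d, h⟩ := X.exists_of_hasForm_one hform
  have line (τ : ℂ) : a + (τ + 1) • c + τ • d = X.mu q * (a + τ • c) := by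
    obtain ⟨t, h₁, h₂, rfl⟩ := X.exists_line_point τ
    have e := hglue t h₁ h₂
    rw [h, h, smul_eq_mu_mul, X.expFn_line₁ t h₁ h₂, X.fnK_line₁ t h₁ h₂, X.fnE_line₁ t h₁ h₂,
      fnE_line₂, fnH_line₁, fnH_line₂, zero_smul, zero_smul, add_zero, add_zero] at e
    have hu : IsUnit (expGerm q X.c₁ X.c₂ * X.expFn q ⟨(t, X.p₂), h₂⟩) :=
      (IsUnit.of_mul_eq_one_right _ (expGerm_neg_mul _ _)).mul (X.isUnit_expFn _)
    refine sub_eq_zero.1 ((mul_eq_zero.1 ?_).resolve_right hu.ne_zero)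
    linear_combination e
  have h0 := line 0
  have h1 := line 1
  simp only [zero_add, zero_smul, one_smul, add_zero, add_smul] at h0 h1
  have hc : c = -(X.gap q * a) := by rw [gap]; linear_combination h0
  have hd : d = X.gap q ^ 2 * a := by
    rw [hc] at h1
    rw [gap] at h1 ⊢
    linear_combination h1
  refine ⟨a, b, funext fun P => ?_⟩
  rw [h, hc, hd, Pi.add_apply, Pi.smul_apply, Pi.smul_apply, genG_apply, genH_apply]
  simp only [Algebra.smul_def, Algebra.algebraMap_self_apply]
  ring

/-! ### The operator module generated by `1` and `fnE` -/

variable (q) in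
/-- The module of all `a • exp + fnE (b • exp)`. -/
def opSpan : Submodule (Dops q) (X.Pt → Oan q) :=
  Submodule.span (Dops q) {X.expFn q, X.scale q X.fnE (X.expFn q)}

theorem expFn_mem_opSpan : X.expFn q ∈ X.opSpan q := Submodule.subset_span (Or.inl rfl)

theorem scale_expFn_mem_opSpan : X.scale q X.fnE (X.expFn q) ∈ X.opSpan q :=
  Submodule.subset_span (Or.inr rfl)

theorem scale_mem_opSpan {ζ : X.Pt → ℂ} (h₁ : X.scale q ζ (X.expFn q) ∈ X.opSpan q)
    (h₂ : X.scale q ζ (X.scale q X.fnE (X.expFn q)) ∈ X.opSpan q) {z : X.Pt → Oan q}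
    (hz : z ∈ X.opSpan q) : X.scale q ζ z ∈ X.opSpan q := by
  have h : X.opSpan q ≤ (X.opSpan q).comap (X.scale q ζ) := by
    refine Submodule.span_le.2 ?_
    rintro w (rfl | rfl)
    · exact h₁
    · exact h₂
  exact h hz

theorem scale_comm (ζ ξ : X.Pt → ℂ) (z : X.Pt → Oan q) :
    X.scale q ζ (X.scale q ξ z) = X.scale q ξ (X.scale q ζ z) :=
  funext fun _ => smul_comm _ _ _

theorem scale_fnH_mem {z : X.Pt → Oan q} (hz : z ∈ X.opSpan q) :
    X.scale q X.fnH z ∈ X.opSpan q := by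
  refine X.scale_mem_opSpan ?_ ?_ hz
  · rw [← opH_smul_expFn]
    exact Submodule.smul_mem _ _ X.expFn_mem_opSpan
  · rw [scale_comm, ← opH_smul_expFn, map_smul]
    exact Submodule.smul_mem _ _ X.scale_expFn_mem_opSpan

theorem scale_fnK_mem {z : X.Pt → Oan q} (hz : z ∈ X.opSpan q) :
    X.scale q X.fnK z ∈ X.opSpan q := by
  refine X.scale_mem_opSpan ?_ ?_ hz
  · rw [← opK_smul_expFn]
    exact Submodule.smul_mem _ _ X.expFn_mem_opSpan
  · rw [scale_comm, ← opK_smul_expFn, map_smul]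
    exact Submodule.smul_mem _ _ X.scale_expFn_mem_opSpan

/-- The only new product is `fnE²`, which the equation of the quadric reduces to terms linear in
`fnE`. -/
theorem scale_fnE_mem {z : X.Pt → Oan q} (hz : z ∈ X.opSpan q) :
    X.scale q X.fnE z ∈ X.opSpan q := by
  refine X.scale_mem_opSpan X.scale_expFn_mem_opSpan ?_ hz
  have h : X.scale q X.fnE (X.scale q X.fnE (X.expFn q))
      = X.scale q X.fnK (X.scale q X.fnE (X.expFn q))
      + algebraMap ℂ (Dops q) (X.rho - 2) • X.scale q X.fnH (X.scale q X.fnE (X.expFn q))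
      + algebraMap ℂ (Dops q) (-1) • X.scale q X.fnE (X.expFn q)
      + X.scale q X.fnK (X.scale q X.fnH (X.expFn q)) := by
    funext P
    simp only [Pi.add_apply, algebraMap_smul_apply, scale_apply, smul_smul, fn_relation]
    module
  rw [h]
  exact add_mem (add_mem (add_mem (X.scale_fnK_mem X.scale_expFn_mem_opSpan)
    (Submodule.smul_mem _ _ (X.scale_fnH_mem X.scale_expFn_mem_opSpan)))
    (Submodule.smul_mem _ _ X.scale_expFn_mem_opSpan))
    (X.scale_fnK_mem (X.scale_fnH_mem X.expFn_mem_opSpan))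

theorem scale_biform_div_mem (B : Matrix (Fin 2) (Fin 2) ℂ) {z : X.Pt → Oan q}
    (hz : z ∈ X.opSpan q) :
    X.scale q (fun P => biform B P.1.1 P.1.2 / biform X.f P.1.1 P.1.2) z ∈ X.opSpan q := by
  have hs := X.f₂₂_ne_zero
  have hA := X.A_ne
  have h : ∃ c₀ c₁ c₂ c₃ : ℂ, ∀ P : X.Pt, biform B P.1.1 P.1.2 / biform X.f P.1.1 P.1.2
      = c₀ + c₁ * X.fnH P + c₂ * X.fnK P + c₃ * X.fnE P := by
    refine ⟨biform B X.p₂ X.p₂ / X.f₂₂,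
      (biform B X.p₂ X.p₁ / X.A - X.rho * biform B X.p₂ X.p₂) / X.f₂₂,
      (biform B X.p₁ X.p₂ / X.A - biform B X.p₂ X.p₂) / X.f₂₂,
      (biform B X.p₁ X.p₁ / X.A ^ 2 - 2 * (biform B X.p₁ X.p₂ / X.A) + biform B X.p₂ X.p₂) / X.f₂₂,
      fun P => ?_⟩
    have hP := P.2
    rw [X.biform_eq B, coord₁_mul_coord₁, coord₁_mul_coord₂, coord₂_mul_coord₁, coord₂_mul_coord₂]
    field_simp
    ring
  obtain ⟨c₀, c₁, c₂, c₃, h⟩ := h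
  have e : X.scale q (fun P => biform B P.1.1 P.1.2 / biform X.f P.1.1 P.1.2) z
      = algebraMap ℂ (Dops q) c₀ • z + algebraMap ℂ (Dops q) c₁ • X.scale q X.fnH z
      + algebraMap ℂ (Dops q) c₂ • X.scale q X.fnK z
      + algebraMap ℂ (Dops q) c₃ • X.scale q X.fnE z := by
    funext P
    simp only [Pi.add_apply, algebraMap_smul_apply, scale_apply, h]
    module
  rw [e]
  exact add_mem (add_mem (add_mem (Submodule.smul_mem _ _ hz)
    (Submodule.smul_mem _ _ (X.scale_fnH_mem hz))) (Submodule.smul_mem _ _ (X.scale_fnK_mem hz)))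
    (Submodule.smul_mem _ _ (X.scale_fnE_mem hz))

theorem exists_monomial_factor {n k : ℕ} (hk : k ≤ n + 1) : ∃ i : Fin 2, ∃ k' ≤ n,
    ∀ u : Fin 2 → ℂ, u 0 ^ k * u 1 ^ (n + 1 - k) = u i * (u 0 ^ k' * u 1 ^ (n - k')) := by
  rcases k with _ | k
  · exact ⟨1, 0, Nat.zero_le n, fun u => by simp [pow_succ']⟩
  · exact ⟨0, k, by omega, fun u => by rw [Nat.add_sub_add_right, pow_succ']; ring⟩

/-- Splitting one linear factor off in each pair of variables leaves a quotient of bidegree `(1, 1)`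
by `f`, and multiplication by such a quotient preserves `opSpan`. -/
theorem scale_monomial_mem (n : ℕ) : ∀ k ≤ n, ∀ l ≤ n,
    X.scale q (fun P => P.1.1 0 ^ k * P.1.1 1 ^ (n - k) * P.1.2 0 ^ l * P.1.2 1 ^ (n - l)
      / biform X.f P.1.1 P.1.2 ^ n) (X.expFn q) ∈ X.opSpan q := by
  induction n with
  | zero =>
    intro k hk l hl
    obtain rfl := Nat.le_zero.1 hk
    obtain rfl := Nat.le_zero.1 hl
    have e : X.scale q (fun P => P.1.1 0 ^ 0 * P.1.1 1 ^ (0 - 0) * P.1.2 0 ^ 0 * P.1.2 1 ^ (0 - 0)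
      / biform X.f P.1.1 P.1.2 ^ 0) (X.expFn q) = X.expFn q := by
      funext P
      simp [scale_apply]
    rw [e]
    exact X.expFn_mem_opSpan
  | succ n ih =>
    intro k hk l hl
    obtain ⟨i, k', hk', hik⟩ := exists_monomial_factor hk
    obtain ⟨j, l', hl', hjl⟩ := exists_monomial_factor hl
    have e : X.scale q (fun P => P.1.1 0 ^ k * P.1.1 1 ^ (n + 1 - k) * P.1.2 0 ^ l
        * P.1.2 1 ^ (n + 1 - l) / biform X.f P.1.1 P.1.2 ^ (n + 1)) (X.expFn q)
        = X.scale q (fun P => biform (Matrix.vecMulVec (Pi.single i 1) (Pi.single j 1)) P.1.1 P.1.2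
          / biform X.f P.1.1 P.1.2) (X.scale q (fun P => P.1.1 0 ^ k' * P.1.1 1 ^ (n - k')
          * P.1.2 0 ^ l' * P.1.2 1 ^ (n - l') / biform X.f P.1.1 P.1.2 ^ n) (X.expFn q)) := by
      funext P
      have hP := P.2
      have hs (i : Fin 2) (u : Fin 2 → ℂ) : (Pi.single i 1 : Fin 2 → ℂ) 0 * u 0
          + (Pi.single i 1 : Fin 2 → ℂ) 1 * u 1 = u i := by
        fin_cases i <;> simp
      simp only [scale_apply, smul_smul, biform_vecMulVec, hs]
      congr 1
      rw [mul_assoc (_ * _), hik, hjl, pow_succ]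
      field_simp
    rw [e]
    exact X.scale_biform_div_mem _ (ih k' hk' l' hl')

theorem mem_opSpan_of_hasForm {n : ℕ} {z : X.Pt → Oan q} (hz : X.HasForm n z) :
    z ∈ X.opSpan q := by
  obtain ⟨c, hc⟩ := hz
  have e : z = ∑ k ∈ Finset.range (n + 1), ∑ l ∈ Finset.range (n + 1), mulOp q (c k l) •
      X.scale q (fun P => P.1.1 0 ^ k * P.1.1 1 ^ (n - k) * P.1.2 0 ^ l * P.1.2 1 ^ (n - l)
        / biform X.f P.1.1 P.1.2 ^ n) (X.expFn q) := by
    funext P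
    simp only [Finset.sum_apply, mulOp_smul_apply, scale_apply]
    rw [hc, form, Finset.smul_sum, Finset.sum_mul]
    refine Finset.sum_congr rfl fun k _ => ?_
    rw [Finset.smul_sum, Finset.sum_mul]
    refine Finset.sum_congr rfl fun l _ => ?_
    rw [smul_smul, smul_mul_assoc, mul_smul_comm, one_div_mul_eq_div]
    rfl
  rw [e]
  exact sum_mem fun k hk => sum_mem fun l hl => Submodule.smul_mem _ _
    (X.scale_monomial_mem n k (by grind) l (by grind))

end SpectralData

namespace SpectralData

variable (X : SpectralData) {q : ℂ × ℂ}

open Polynomial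

/-! ### Freeness and generation -/

theorem level_le_baModule {n : ℕ} (hn : 1 ≤ n) {ψ : X.Pt → Oan q} (h : ψ ∈ X.level q n) :
    ψ ∈ X.baModule q :=
  Set.mem_iUnion.2 ⟨n, Set.mem_iUnion.2 ⟨hn, h⟩⟩

theorem exists_level_of_mem_baModule {φ : X.Pt → Oan q} (h : φ ∈ X.baModule q) :
    ∃ n, φ ∈ X.level q n := by
  obtain ⟨n, h⟩ := Set.mem_iUnion.1 h
  obtain ⟨_, h⟩ := Set.mem_iUnion.1 h
  exact ⟨n, h⟩

/-- An element of the module without `fnE` part is a multiple of `genH`. -/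
theorem exists_smul_genH {a : Dops q} (ha : X.Glued (a • X.expFn q)) :
    ∃ d : Dops q, a • X.expFn q = d • X.genH q := by
  obtain ⟨R, rfl⟩ := X.normalForm_surjective a
  -- Equality would mean `gap = 0`.
  have hne : expGerm q X.c₁ X.c₂ ≠ algebraMap ℂ (Oan q) X.Λ := by
    intro h
    refine X.gap_ne_zero (q := q) ?_
    have := X.smul_eq_mu_mul (q := q) 1
    rw [Algebra.smul_def, ← h, mul_one] at this
    rw [gap, sub_eq_zero]
    refine mul_right_cancel₀ (b := expGerm q X.c₁ X.c₂) ?_ ((one_mul _).trans this)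
    exact (IsUnit.of_mul_eq_one_right _ (expGerm_neg_mul _ _)).ne_zero
  -- The constant coefficient in the outer variable is the symbol at `fnH = 0`. The gluing turns it
  -- into a solution of the shift equation, with `τ` the value of `fnK` on the second line.
  have h0 : R.coeff 0 = 0 := by
    refine eq_zero_of_shift hne fun τ => ?_
    obtain ⟨t, h₁, h₂, rfl⟩ := X.exists_line_point τ
    have e := ha t h₁ h₂
    rw [normalForm_smul_expFn, normalForm_smul_expFn, X.expFn_line₁ t h₁ h₂, fnH_line₁, fnH_line₂,
      X.fnK_line₁ t h₁ h₂, map_zero, evalEval, evalEval, C_0, ← coeff_zero_eq_eval_zero,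
      Algebra.smul_def] at e
    refine sub_eq_zero.1 ((mul_eq_zero.1 ?_).resolve_right
      (X.isUnit_expFn ⟨(t, X.p₂), h₂⟩).ne_zero)
    linear_combination e
  obtain ⟨S, rfl⟩ := exists_eq_mul_X h0
  exact ⟨X.normalForm q S, by rw [normalForm_mul_X, mul_smul, genH]⟩

theorem smul_genG_add_smul_genH (d e : Dops q) : d • X.genG q + e • X.genH q
    = (d * (1 + mulOp q (-X.gap q) * X.opK q) + e * X.opH q) • X.expFn q
      + X.scale q X.fnE ((d * mulOp q (X.gap q ^ 2)) • X.expFn q) := by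
  rw [genG, genH, smul_add, ← map_smul, ← mul_smul, ← mul_smul, ← mul_smul, add_smul]
  abel

theorem mulOp_neg_one_smul (z : X.Pt → Oan q) : mulOp q (-1) • z = -z :=
  funext fun P => by
    change (-1 : Oan q) * z P = -z P
    ring

/-- `genG` and `genH` generate the module up to powers of `gap`. -/
theorem exists_gap_pow_smul {φ : X.Pt → Oan q} (hφ : φ ∈ X.baModule q) :
    ∃ (N : ℕ) (d e : Dops q), mulOp q (X.gap q ^ N) • φ = d • X.genG q + e • X.genH q := by
  obtain ⟨n, hn⟩ := X.exists_level_of_mem_baModule hφ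
  obtain ⟨a, b, hab⟩ := Submodule.mem_span_pair.1 (X.mem_opSpan_of_hasForm hn.1)
  -- The `fnE` part of `d • genG` is `d * gap²`, so `b` must first be made right divisible by
  -- `gap²`.
  obtain ⟨N, d, hd⟩ := exists_pow_mul_eq_mul b (X.gap q ^ 2)
  have hG : X.genG q ∈ X.baModule q := X.level_le_baModule le_rfl X.genG_mem_level
  have hmem : mulOp q ((X.gap q ^ 2) ^ N) • φ + (mulOp q (-1) * d) • X.genG q ∈ X.baModule q :=
    add_mem (Submodule.smul_mem _ _ hφ) (Submodule.smul_mem _ _ hG)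
  have heq : mulOp q ((X.gap q ^ 2) ^ N) • φ + (mulOp q (-1) * d) • X.genG q
      = (mulOp q ((X.gap q ^ 2) ^ N) * a
        + mulOp q (-1) * d * (1 + mulOp q (-X.gap q) * X.opK q)) • X.expFn q := by
    have h1 := X.smul_genG_add_smul_genH (mulOp q (-1) * d) 0
    rw [zero_smul, add_zero, zero_mul, add_zero, mul_assoc _ d (mulOp q (X.gap q ^ 2)),
      mul_smul _ (d * mulOp q (X.gap q ^ 2)), mulOp_neg_one_smul, map_neg (X.scale q X.fnE)] at h1
    rw [h1, ← hab, smul_add, ← map_smul (X.scale q X.fnE), ← map_smul (X.scale q X.fnE),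
      ← mul_smul, ← mul_smul, hd, add_smul]
    abel
  rw [heq] at hmem
  -- The difference has lost its `fnE` part but is still glued, being in the module.
  obtain ⟨m, hm⟩ := X.exists_level_of_mem_baModule hmem
  obtain ⟨e, he⟩ := X.exists_smul_genH hm.2
  refine ⟨2 * N, d, e, ?_⟩
  rw [pow_mul, ← he, ← heq, mul_smul, mulOp_neg_one_smul]
  abel

/-- `genG` and `genH` are independent over differential operators. -/
theorem eq_zero_of_smul_genG_add_smul_genH {d e : Dops q}
    (h : d • X.genG q + e • X.genH q = 0) : d = 0 ∧ e = 0 := by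
  rw [smul_genG_add_smul_genH] at h
  obtain ⟨h1, h2⟩ := X.eq_zero_of_smul_expFn_add h
  -- The `fnE` part of the combination is `d * gap²`.
  have hd : d = 0 := X.eq_zero_of_mul_mulOp (pow_ne_zero 2 X.gap_ne_zero) h2
  rw [hd, zero_mul, zero_add] at h1
  exact ⟨hd, X.eq_zero_of_mul_opH h1⟩

/-! ### Arbitrary pairs in the span of `genG` and `genH` -/

section Pair

variable {a₁ b₁ a₂ b₂ : Oan q} {ψ₁ ψ₂ : X.Pt → Oan q}

theorem eq_zero_of_smul_add_smul
    (h₁ : ψ₁ = a₁ • X.genG q + b₁ • X.genH q)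
    (h₂ : ψ₂ = a₂ • X.genG q + b₂ • X.genH q)
    (hΔ : a₁ * b₂ - a₂ * b₁ ≠ 0) {d₁ d₂ : Dops q}
    (h : d₁ • ψ₁ + d₂ • ψ₂ = 0) : d₁ = 0 ∧ d₂ = 0 := by
  have e₁ : ψ₁ = mulOp q a₁ • X.genG q + mulOp q b₁ • X.genH q := h₁
  have e₂ : ψ₂ = mulOp q a₂ • X.genG q + mulOp q b₂ • X.genH q := h₂
  have hG : (d₁ * mulOp q a₁ + d₂ * mulOp q a₂) • X.genG q
      + (d₁ * mulOp q b₁ + d₂ * mulOp q b₂) • X.genH q = 0 := by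
    rw [← h, e₁, e₂, add_smul, add_smul, smul_add, smul_add]
    simp only [mul_smul]
    abel
  obtain ⟨hA, hB⟩ := X.eq_zero_of_smul_genG_add_smul_genH hG
  constructor
  · refine X.eq_zero_of_mul_mulOp hΔ ?_
    -- Cramer's rule with the matrix acting on the right of the operators; its entries are germs and
    -- commute among themselves.
    have e : d₁ * mulOp q (a₁ * b₂ - a₂ * b₁) = (d₁ * mulOp q a₁ + d₂ * mulOp q a₂) * mulOp q b₂
        - (d₁ * mulOp q b₁ + d₂ * mulOp q b₂) * mulOp q a₂ := by
      rw [add_mul, add_mul, mul_assoc, mul_assoc, mul_assoc, mul_assoc, ← map_mul, ← map_mul,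
        ← map_mul, ← map_mul, map_sub, mul_comm b₁, mul_comm b₂ a₂, mul_sub]
      abel
    rw [e, hA, hB, zero_mul, zero_mul, sub_zero]
  · refine X.eq_zero_of_mul_mulOp hΔ ?_
    have e : d₂ * mulOp q (a₁ * b₂ - a₂ * b₁) = (d₁ * mulOp q b₁ + d₂ * mulOp q b₂) * mulOp q a₁
        - (d₁ * mulOp q a₁ + d₂ * mulOp q a₂) * mulOp q b₁ := by
      rw [add_mul, add_mul, mul_assoc, mul_assoc, mul_assoc, mul_assoc, ← map_mul, ← map_mul,
        ← map_mul, ← map_mul, map_sub, mul_comm b₁ a₁, mul_comm b₂ a₁, mul_sub]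
      abel
    rw [e, hA, hB, zero_mul, zero_mul, sub_zero]

/-- By Cramer's rule the determinant times `genG` or `genH` lies in the `𝒪`-span of `ψ₁`, `ψ₂`. The
Ore condition brings the determinant to the right of the operators in front of the generators, at
the cost of a power on the left. -/
theorem exists_pow_smul_eq
    (h₁ : ψ₁ = a₁ • X.genG q + b₁ • X.genH q)
    (h₂ : ψ₂ = a₂ • X.genG q + b₂ • X.genH q)
    {φ : X.Pt → Oan q} (hφ : φ ∈ X.baModule q) :
    ∃ (M N : ℕ) (d₁ d₂ : Dops q), d₁ • ψ₁ + d₂ • ψ₂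
      = ((a₁ * b₂ - a₂ * b₁) ^ M * X.gap q ^ N) • φ := by
  obtain ⟨N, d, e, h⟩ := X.exists_gap_pow_smul hφ
  set Δ := a₁ * b₂ - a₂ * b₁ with hΔ
  obtain ⟨K, d', hd⟩ := exists_pow_mul_eq_mul d Δ
  obtain ⟨L, e', he⟩ := exists_pow_mul_eq_mul e Δ
  have hG : mulOp q Δ • X.genG q = mulOp q b₂ • ψ₁ + mulOp q (-b₁) • ψ₂ := by
    funext P
    rw [h₁, h₂, hΔ]
    simp only [Pi.add_apply, Pi.smul_apply, mulOp_smul_germ, smul_eq_mul]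
    ring
  have hH : mulOp q Δ • X.genH q = mulOp q (-a₂) • ψ₁ + mulOp q a₁ • ψ₂ := by
    funext P
    rw [h₁, h₂, hΔ]
    simp only [Pi.add_apply, Pi.smul_apply, mulOp_smul_germ, smul_eq_mul]
    ring
  refine ⟨L + K, N, mulOp q (Δ ^ L) * d' * mulOp q b₂ + mulOp q (Δ ^ K) * e' * mulOp q (-a₂),
    mulOp q (Δ ^ L) * d' * mulOp q (-b₁) + mulOp q (Δ ^ K) * e' * mulOp q a₁, ?_⟩
  change _ = mulOp q (Δ ^ (L + K) * X.gap q ^ N) • φ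
  have hd' : mulOp q (Δ ^ (L + K)) * d = mulOp q (Δ ^ L) * d' * mulOp q Δ := by
    rw [pow_add, map_mul, mul_assoc, hd, mul_assoc]
  have he' : mulOp q (Δ ^ (L + K)) * e = mulOp q (Δ ^ K) * e' * mulOp q Δ := by
    rw [add_comm, pow_add, map_mul, mul_assoc, he, mul_assoc]
  rw [map_mul, mul_smul, h, smul_add, ← mul_smul, ← mul_smul, hd', he', mul_smul _ (mulOp q Δ),
    mul_smul _ (mulOp q Δ), hG, hH]
  simp only [smul_add, add_smul, mul_smul]
  abel

end Pair

/-- If the determinant vanished, the columns of the matrix would give relations forcing `a = b = 0`,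
hence a zero vector in the pair. Nothing is required of `v` and `w`, so this serves both over `ℂ` at
the base point and over `𝒪`. -/
theorem det_ne_zero_of_linearIndependent {R V : Type*} [CommRing R] [Nontrivial R]
    [AddCommGroup V] [Module R V] {a b c d : R} {v w : V}
    (h : LinearIndependent R ![a • v + b • w, c • v + d • w]) : a * d - c * b ≠ 0 := by
  intro hz
  rw [LinearIndependent.pair_iff] at h
  have h1 := h c (-a) (by
    have : c • (a • v + b • w) + -a • (c • v + d • w) = -((a * d - c * b) • w) := by module
    rw [this, hz, zero_smul, neg_zero])
  have h2 := h d (-b) (by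
    have : d • (a • v + b • w) + -b • (c • v + d • w) = (a * d - c * b) • v := by module
    rw [this, hz, zero_smul])
  have ha : a = 0 := neg_eq_zero.1 h1.2
  have hb : b = 0 := neg_eq_zero.1 h2.2
  exact one_ne_zero (h 1 0 (by simp [ha, hb])).1

theorem atBase_smul_add_smul (a b : Oan q) (z w : X.Pt → Oan q) :
    atBase (a • z + b • w) = valueHom q a • atBase z + valueHom q b • atBase w := by
  funext P
  change valueHom q (a * z P + b * w P) = valueHom q a * valueHom q (z P)
    + valueHom q b * valueHom q (w P)
  rw [map_add, map_mul, map_mul]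

theorem linearIndependent_atBase_gen :
    LinearIndependent ℂ ![atBase (X.genG q), atBase (X.genH q)] := by
  rw [LinearIndependent.pair_iff]
  intro s t h
  have hpt (P : X.Pt) : s * (1 - X.fnK P * valueHom q (X.gap q)
      + X.fnE P * valueHom q (X.gap q) ^ 2) + t * X.fnH P = 0 := by
    have e := congrFun h P
    change s * valueHom q (X.genG q P) + t * valueHom q (X.genH q P) = 0 at e
    rw [genG_apply, genH_apply, map_mul, valueHom_smul, map_add, map_sub, map_one, valueHom_smul,
      valueHom_smul, map_pow] at e
    refine (mul_eq_zero.1 ?_).resolve_right ((X.isUnit_expFn (q := q) P).map (valueHom q)).ne_zero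
    linear_combination e
  -- With `fnK = fnE = 0` the quadric contains every value of `fnH`: at `0` only `genG` contributes,
  -- and at `1` the coefficient of `genH` appears.
  obtain ⟨P, hH, hK, hE⟩ := X.exists_point (h := 0) (k := 0) (e := 0) (by ring)
  obtain ⟨Q, hH', hK', hE'⟩ := X.exists_point (h := 1) (k := 0) (e := 0) (by ring)
  have e₁ := hpt P
  have e₂ := hpt Q
  rw [hH, hK, hE] at e₁
  rw [hH', hK', hE'] at e₂
  have hs : s = 0 := by linear_combination e₁
  exact ⟨hs, by rw [hs] at e₂; linear_combination e₂⟩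

theorem isUnit_gap (h : X.Λ ≠ Complex.exp (q.1 * X.c₁ + q.2 * X.c₂)) : IsUnit (X.gap q) := by
  refine isUnit_of_valueHom_ne_zero ?_
  rw [valueHom_gap, Complex.exp_neg, sub_ne_zero]
  intro e
  apply h
  have := Complex.exp_ne_zero (q.1 * X.c₁ + q.2 * X.c₂)
  field_simp at e
  exact e.symm

end SpectralData

end BakerAkhiezer

end

theorem theorem2 (X : BakerAkhiezer.SpectralData) (q : ℂ × ℂ) :
    (∃ ψ₁ ∈ X.level q 1, ∃ ψ₂ ∈ X.level q 1,
      LinearIndependent ℂ ![BakerAkhiezer.SpectralData.atBase ψ₁,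
        BakerAkhiezer.SpectralData.atBase ψ₂]) ∧
    ∀ ψ₁ ∈ X.level q 1, ∀ ψ₂ ∈ X.level q 1,
      (LinearIndependent ℂ ![BakerAkhiezer.SpectralData.atBase ψ₁,
          BakerAkhiezer.SpectralData.atBase ψ₂] →
        X.Λ ≠ Complex.exp (q.1 * X.c₁ + q.2 * X.c₂) →
        (∀ φ ∈ X.baModule q, ∃! d : BakerAkhiezer.Dops q × BakerAkhiezer.Dops q,
          d.1 • ψ₁ + d.2 • ψ₂ = φ) ∧
        ∃ b : Module.Basis (Fin 2) (BakerAkhiezer.Dops q) (X.baModule q),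
          (b 0 : X.Pt → BakerAkhiezer.Oan q) = ψ₁ ∧ (b 1 : X.Pt → BakerAkhiezer.Oan q) = ψ₂) ∧
      (LinearIndependent (BakerAkhiezer.Oan q) ![ψ₁, ψ₂] →
        LinearIndependent (BakerAkhiezer.Dops q) ![ψ₁, ψ₂] ∧
        ∀ φ ∈ X.baModule q, ∃ g : BakerAkhiezer.Oan q, g ≠ 0 ∧
          ∃ d₁ d₂ : BakerAkhiezer.Dops q, d₁ • ψ₁ + d₂ • ψ₂ = g • φ) := by
  open BakerAkhiezer in
  refine ⟨⟨_, X.genG_mem_level, _, X.genH_mem_level, X.linearIndependent_atBase_gen⟩, ?_⟩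
  intro ψ₁ hψ₁ ψ₂ hψ₂
  obtain ⟨a₁, b₁, h₁⟩ := X.exists_of_mem_level_one hψ₁
  obtain ⟨a₂, b₂, h₂⟩ := X.exists_of_mem_level_one hψ₂
  have indep (hΔ : a₁ * b₂ - a₂ * b₁ ≠ 0) : LinearIndependent (Dops q) ![ψ₁, ψ₂] := by
    rw [LinearIndependent.pair_iff]
    intro d₁ d₂ h
    exact X.eq_zero_of_smul_add_smul h₁ h₂ hΔ h
  refine ⟨fun hbase hΛ => ?_, fun hind => ?_⟩
  -- The value of the determinant at `q` is the determinant of the two functions at the base point,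
  -- and a germ with nonzero value is a unit.
  · have hΔ : IsUnit (a₁ * b₂ - a₂ * b₁) := by
      refine isUnit_of_valueHom_ne_zero ?_
      rw [h₁, h₂, X.atBase_smul_add_smul, X.atBase_smul_add_smul] at hbase
      rw [map_sub, map_mul, map_mul]
      exact SpectralData.det_ne_zero_of_linearIndependent hbase
    have hex (φ) (hφ : φ ∈ X.baModule q) : ∃ d₁ d₂ : Dops q, d₁ • ψ₁ + d₂ • ψ₂ = φ := by
      obtain ⟨M, N, d₁, d₂, h⟩ := X.exists_pow_smul_eq h₁ h₂ hφ
      obtain ⟨u, hu⟩ := ((hΔ.pow M).mul ((X.isUnit_gap hΛ).pow N)).exists_left_inv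
      refine ⟨mulOp q u * d₁, mulOp q u * d₂, ?_⟩
      rw [mul_smul, mul_smul, ← smul_add, h]
      change u • (_ • φ) = φ
      rw [smul_smul, hu, one_smul]
    have hlin := indep hΔ.ne_zero
    have huniq : ∀ d e : Dops q × Dops q, d.1 • ψ₁ + d.2 • ψ₂ = e.1 • ψ₁ + e.2 • ψ₂ → d = e := by
      intro d e h
      have hz : (d.1 + mulOp q (-1) * e.1) • ψ₁ + (d.2 + mulOp q (-1) * e.2) • ψ₂ = 0 := by
        rw [add_smul, add_smul, mul_smul, mul_smul, add_add_add_comm, ← smul_add, h,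
          X.mulOp_neg_one_smul, add_neg_cancel]
      obtain ⟨e₁, e₂⟩ := X.eq_zero_of_smul_add_smul h₁ h₂ hΔ.ne_zero hz
      rw [map_neg, map_one, neg_one_mul, add_neg_eq_zero] at e₁ e₂
      exact Prod.ext e₁ e₂
    refine ⟨fun φ hφ => ?_, ?_⟩
    · obtain ⟨d₁, d₂, h⟩ := hex φ hφ
      exact ⟨(d₁, d₂), h, fun e he => huniq _ _ (he.trans h.symm)⟩
    · let v : Fin 2 → X.baModule q :=
        ![⟨ψ₁, X.level_le_baModule le_rfl hψ₁⟩, ⟨ψ₂, X.level_le_baModule le_rfl hψ₂⟩]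
      have hv : LinearIndependent (Dops q) v := by
        refine LinearIndependent.of_comp (X.baModule q).subtype ?_
        have e : (X.baModule q).subtype ∘ v = ![ψ₁, ψ₂] := by
          funext i
          fin_cases i <;> rfl
        rw [e]
        exact hlin
      have hspan : ⊤ ≤ Submodule.span (Dops q) (Set.range v) := by
        rintro ⟨φ, hφ⟩ -
        obtain ⟨d₁, d₂, h⟩ := hex φ hφ
        have hmem : φ ∈ (Submodule.span (Dops q) (Set.range v)).map (X.baModule q).subtype := by
          have hm (i : Fin 2) : (v i : X.Pt → Oan q)
              ∈ (Submodule.span (Dops q) (Set.range v)).map (X.baModule q).subtype :=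
            Submodule.mem_map_of_mem (f := (X.baModule q).subtype)
              (Submodule.subset_span (Set.mem_range_self i))
          rw [← h]
          exact add_mem (Submodule.smul_mem _ d₁ (hm 0)) (Submodule.smul_mem _ d₂ (hm 1))
        obtain ⟨w, hw, rfl⟩ := hmem
        exact hw
      refine ⟨Module.Basis.mk hv hspan, ?_, ?_⟩
      · rw [Module.Basis.mk_apply]
        rfl
      · rw [Module.Basis.mk_apply]
        rfl
  · have hΔ : a₁ * b₂ - a₂ * b₁ ≠ 0 := by
      rw [h₁, h₂] at hind
      exact SpectralData.det_ne_zero_of_linearIndependent hind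
    refine ⟨indep hΔ, fun φ hφ => ?_⟩
    obtain ⟨M, N, d₁, d₂, h⟩ := X.exists_pow_smul_eq h₁ h₂ hφ
    -- The denominator is a power of the determinant times a power of `gap`, nonzero because `𝒪` is
    -- a domain.
    exact ⟨_, mul_ne_zero (pow_ne_zero M hΔ) (pow_ne_zero N X.gap_ne_zero), d₁, d₂, h⟩
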